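/- Let $F_2$ be the free group of rank $2$, let $\varphi$ be an automorphism of $F_2$, and let $G=F_2\rtimes_\varphi\mathbb{Z}$, where the generator $t$ of $\mathbb{Z}$ acts on $F_2$ by $t^{-1}xt=\varphi(x)$. Let $\gamma_\alpha(G)$ denote the transfinite lower central series of $G$: $\gamma_1(G)=G$, $\gamma_{\alpha+1}(G)=[\gamma_\alpha(G),G]$ for every ordinal $\alpha\ge 1$, and $\gamma_\alpha(G)=\bigcap_{1\le\beta<\alpha}\gamma_\beta(G)$ for every limit ordinal $\alpha$. The length of the lower central series of $G$ is the smallest ordinal $\alpha\ge 1$ such that $\gamma_\alpha(G)=\gamma_{\alpha+1}(G)$. Then exactly one of the following three statements holds: a) $\gamma_\omega(G)=\gamma_2(G)$; b) $\gamma_\omega(G)=1$; c) $\gamma_{\omega^2}(G)=1$ and the length of the lower central series of $G$ is equal to $\omega^2$. -/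

import Mathlib

universe u

/-- The transfinite lower central series `γ_α(G)`, indexed from `1` as usual:
`γ_1(G) = G`, `γ_{α+1}(G) = [γ_α(G), G]` for `α ≥ 1`, and `γ_α(G) = ⋂_{β<α} γ_β(G)` for a limit
ordinal `α`. The index `0` is not used; by convention `γ_0(G) = G`. -/
noncomputable def lcs (G : Type u) [Group G] (α : Ordinal.{u}) : Subgroup G :=
  Ordinal.limitRecOn α ⊤
    (fun β H => if β = 0 then ⊤ else ⁅H, (⊤ : Subgroup G)⁆)
    (fun β _ H => ⨅ (γ : Ordinal.{u}) (h : γ < β), H γ h)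

theorem lcs_zero (G : Type u) [Group G] : lcs G 0 = ⊤ := by
  simp [lcs]

theorem lcs_one (G : Type u) [Group G] : lcs G 1 = ⊤ := by
  unfold lcs
  rw [show (1 : Ordinal.{u}) = 0 + 1 by simp, Ordinal.limitRecOn_add_one]
  simp

theorem lcs_add_one (G : Type u) [Group G] {α : Ordinal.{u}} (hα : 1 ≤ α) :
    lcs G (α + 1) = ⁅lcs G α, (⊤ : Subgroup G)⁆ := by
  have h0 : α ≠ 0 := by
    rintro rfl
    simp at hα
  unfold lcs
  rw [Ordinal.limitRecOn_add_one, if_neg h0]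

theorem lcs_limit (G : Type u) [Group G] {α : Ordinal.{u}} (hα : Order.IsSuccLimit α) :
    lcs G α = ⨅ (β : Ordinal.{u}) (_ : β < α), lcs G β := by
  unfold lcs
  rw [Ordinal.limitRecOn_limit]
  exact hα

/-- The finite terms agree with Mathlib's series, which starts at index `0`. -/
theorem lcs_nat (G : Type u) [Group G] (n : ℕ) :
    lcs G ((n + 1 : ℕ) : Ordinal.{u}) = (⊤ : Subgroup G).lowerCentralSeries n := by
  induction n with
  | zero => simp [lcs_one]
  | succ k ih =>
    rw [Nat.cast_succ, lcs_add_one G (by simp), ih]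
    rfl

/-- `α` is the length of the lower central series of `G`: the smallest ordinal `α ≥ 1` such that
`γ_α(G) = γ_{α+1}(G)`. -/
def IsLowerCentralLength (G : Type u) [Group G] (α : Ordinal.{u}) : Prop :=
  IsLeast {β : Ordinal.{u} | 1 ≤ β ∧ lcs G β = lcs G (β + 1)} α

/-- The group `F_2 ⋊_φ ℤ`, where the generator `t` of `ℤ` acts by `t⁻¹ x t = φ(x)`. In Mathlib's
semidirect product the action of `t` is `x ↦ t x t⁻¹`, which is therefore `φ⁻¹`. -/
abbrev FreeTwoByZ (φ : MulAut (FreeGroup (Fin 2))) : Type :=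
  FreeGroup (Fin 2) ⋊[zpowersHom (MulAut (FreeGroup (Fin 2))) φ⁻¹] Multiplicative ℤ

theorem FreeTwoByZ.conj_eq (φ : MulAut (FreeGroup (Fin 2))) (x : FreeGroup (Fin 2)) :
    (SemidirectProduct.inr (Multiplicative.ofAdd 1) : FreeTwoByZ φ)⁻¹ * SemidirectProduct.inl x *
      SemidirectProduct.inr (Multiplicative.ofAdd 1) = SemidirectProduct.inl (φ x) := by
  rw [← map_inv, ← SemidirectProduct.inl_aut_inv]
  simp

open scoped commutatorElement
open SemidirectProduct

/-! Everything is decided by the matrix M of φ on F₂^ab = ℤ², with trace τ and determinant ±1. Note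
det(1 - M) = 1 - τ + det M. All γ_α with α ≥ 2 lie in F₂, and commutation with t acts on exponent
vectors as M - 1.

If det(1 - M) = ±1, then M - 1 is invertible over ℤ and every finite term from γ_2 on is F₂: case a)
(`lcs_omega_eq_two`).

If M is unipotent modulo a prime p (τ ≡ 2, det ≡ 1), filter ℤ[F₂] by powers of J, the elements of
augmentation divisible by p. The operator (φ - 1)^p maps J^{k+1} into J^{k+2}, so finitely many
commutators lower the layer by one. A free group of matrices congruent to 1 mod p shows that only g
= 1 has g - 1 in all J^k: case b) (`lcs_omega_eq_bot`). Such p exists if det = 1 and |2 - τ| ≠ 1,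
and p = 2 works if det = -1 and τ is even.

There remain det = -1, τ odd, |τ| ≥ 3: case c). From below, [F₂,F₂] ≤ γ_ω, because c = [x,y] has
both c^(2^n) and c^(τ^n) in the terms of the series modulo [[F₂,F₂],F₂]. Since [γ_α, γ_ω] ≤ γ_{α+ω},
iterated commutators survive in every γ_{ωn}; a quotient S₄ shows that they are nontrivial
(`lcs_omega_mul_ne_bot`). From above, extend scalars to ℤ[λ], λ² = τλ + 1, where M has two
eigenforms. On leading Magnus coefficients φ acts diagonally by products ν_w of the eigenvalues, and
no ν_w - 1 is a unit, so ω commutators with t kill one degree; hence γ_{ωk} lies in degree ≥ k and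
γ_{ω²} = 1 (`lcs_omega_mul_le`, `lcs_omega_sq_eq_bot`). -/

/-! ### Transfinite lower central series of an arbitrary group -/

theorem lcs_normal (G : Type u) [Group G] (α : Ordinal.{u}) : (lcs G α).Normal := by
  induction α using Ordinal.limitRecOn with
  | zero => rw [lcs_zero]; infer_instance
  | add_one β ih =>
    rcases eq_or_ne β 0 with rfl | hβ
    · rw [zero_add, lcs_one]; infer_instance
    · rw [lcs_add_one G (Order.one_le_iff_ne_zero.2 hβ)]
      infer_instance
  | limit β hβ ih =>
    rw [lcs_limit G hβ]
    exact Subgroup.normal_iInf_normal fun γ => Subgroup.normal_iInf_normal fun h => ih γ h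

theorem lcs_antitone (G : Type u) [Group G] : Antitone (lcs G) := by
  intro α β
  induction β using Ordinal.limitRecOn with
  | zero =>
    intro h
    rw [show α = 0 by simpa using h]
  | add_one β ih =>
    intro h
    rcases h.eq_or_lt with rfl | h
    · exact le_rfl
    · have h' : α ≤ β := Order.lt_add_one_iff.1 h
      rcases eq_or_ne β 0 with rfl | hβ
      · rw [show α = 0 by simpa using h', lcs_zero]; exact le_top
      · have := lcs_normal G β
        refine le_trans ?_ (ih h')
        rw [lcs_add_one G (Order.one_le_iff_ne_zero.2 hβ)]
        exact Subgroup.commutator_le_left _ _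
  | limit β hβ ih =>
    intro h
    rcases h.eq_or_lt with rfl | h
    · exact le_rfl
    · rw [lcs_limit G hβ]; exact iInf₂_le α h

theorem lcs_eq_of_stable (G : Type u) [Group G] {α : Ordinal.{u}} (hα : 1 ≤ α)
    (h : lcs G α = lcs G (α + 1)) {β : Ordinal.{u}} (hβ : α ≤ β) : lcs G β = lcs G α := by
  induction β using Ordinal.limitRecOn with
  | zero => exact absurd (hα.trans hβ) (by simp)
  | add_one β ih =>
    rcases hβ.eq_or_lt with rfl | h'
    · rfl
    · have h' : α ≤ β := Order.lt_add_one_iff.1 h'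
      rw [lcs_add_one G (hα.trans h'), ih h', ← lcs_add_one G hα, ← h]
  | limit β hl ih =>
    refine le_antisymm (lcs_antitone G hβ) ?_
    rw [lcs_limit G hl]
    refine le_iInf₂ fun γ hγ => ?_
    rcases le_total α γ with h' | h'
    · exact (ih γ hγ h').ge
    · exact lcs_antitone G h'

theorem Subgroup.commutator_commutator_le_of_rotate {G : Type*} [Group G]
    {A B C N : Subgroup G} [N.Normal] (h1 : ⁅⁅B, C⁆, A⁆ ≤ N) (h2 : ⁅⁅C, A⁆, B⁆ ≤ N) :
    ⁅⁅A, B⁆, C⁆ ≤ N := by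
  have key : ∀ H : Subgroup G, H ≤ N ↔ H.map (QuotientGroup.mk' N) = ⊥ := fun H => by
    rw [Subgroup.map_eq_bot_iff, QuotientGroup.ker_mk']
  rw [key] at h1 h2 ⊢
  simp only [Subgroup.map_commutator] at h1 h2 ⊢
  exact Subgroup.commutator_commutator_eq_bot_of_rotate h1 h2

/-- Three subgroups lemma, by induction on k. Ordinal addition is not commutative; with a finite
second index, α + 1 + (k + 1) = α + (k + 2) still holds. -/
theorem lcs_commutator_natCast_le (G : Type u) [Group G] (k : ℕ) :
    ∀ α : Ordinal.{u}, 1 ≤ α → ⁅lcs G α, lcs G ((k + 1 : ℕ) : Ordinal.{u})⁆ ≤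
      lcs G (α + ((k + 1 : ℕ) : Ordinal.{u})) := by
  induction k with
  | zero =>
    intro α hα
    simp [lcs_add_one G hα, lcs_one]
  | succ k ih =>
    intro α hα
    have hn := lcs_normal G (α + ((k + 1 + 1 : ℕ) : Ordinal.{u}))
    have h1 : (1 : Ordinal.{u}) ≤ ((k + 1 : ℕ) : Ordinal.{u}) := by simp
    have e : α + ((k + 1 + 1 : ℕ) : Ordinal.{u}) = α + ((k + 1 : ℕ) : Ordinal.{u}) + 1 := by
      rw [Nat.cast_succ (k + 1), add_assoc]
    have e' : α + ((k + 1 + 1 : ℕ) : Ordinal.{u}) = α + 1 + ((k + 1 : ℕ) : Ordinal.{u}) := by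
      rw [show k + 1 + 1 = 1 + (k + 1) by omega, Nat.cast_add 1, Nat.cast_one, add_assoc]
    rw [Nat.cast_succ (k + 1), lcs_add_one G h1, Subgroup.commutator_comm]
    rw [← Nat.cast_succ (k + 1)]
    apply Subgroup.commutator_commutator_le_of_rotate
    · rw [Subgroup.commutator_comm ⊤, ← lcs_add_one G hα, e']
      exact ih _ (hα.trans (by simp))
    · rw [e, lcs_add_one G (hα.trans (by simp))]
      exact Subgroup.commutator_mono (ih α hα) le_rfl

theorem le_lcs_add_omega (G : Type u) [Group G] {α : Ordinal.{u}} {S : Subgroup G}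
    (h : ∀ k : ℕ, S ≤ lcs G (α + k)) : S ≤ lcs G (α + Ordinal.omega0) := by
  rw [lcs_limit G (Ordinal.isSuccLimit_add α Ordinal.isSuccLimit_omega0)]
  refine le_iInf₂ fun β hβ => ?_
  obtain ⟨c, hc, hβ⟩ := (Ordinal.lt_add_iff_of_isSuccLimit Ordinal.isSuccLimit_omega0).1 hβ
  obtain ⟨k, rfl⟩ := Ordinal.lt_omega0.1 hc
  exact (h k).trans (lcs_antitone G hβ.le)

theorem le_lcs_omega (G : Type u) [Group G] {S : Subgroup G}
    (h : ∀ k : ℕ, S ≤ lcs G ((k + 1 : ℕ) : Ordinal.{u})) : S ≤ lcs G Ordinal.omega0 := by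
  rw [← zero_add Ordinal.omega0]
  refine le_lcs_add_omega G fun k => (h k).trans (lcs_antitone G ?_)
  rw [zero_add]; norm_cast; omega

theorem lcs_add_omega_le (G : Type u) [Group G] (α : Ordinal.{u}) (k : ℕ) :
    lcs G (α + Ordinal.omega0) ≤ lcs G (α + k) :=
  lcs_antitone G (by gcongr; exact (Ordinal.natCast_lt_omega0 k).le)

theorem lcs_omega_le (G : Type u) [Group G] (k : ℕ) : lcs G Ordinal.omega0 ≤ lcs G (k : Ordinal) :=
  lcs_antitone G (Ordinal.natCast_lt_omega0 k).le

/-- The commutator of a subgroup of `γ_α(G)` with a subgroup of `γ_ω(G)` lies in `γ_{α+ω}(G)`. -/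
theorem lcs_commutator_omega_le (G : Type u) [Group G] {α : Ordinal.{u}} (hα : 1 ≤ α)
    {S K : Subgroup G} (hS : S ≤ lcs G α) (hK : K ≤ lcs G Ordinal.omega0) :
    ⁅S, K⁆ ≤ lcs G (α + Ordinal.omega0) := by
  refine le_lcs_add_omega G fun k => ?_
  refine (Subgroup.commutator_mono hS (hK.trans (lcs_omega_le G (k + 1)))).trans ?_
  refine (lcs_commutator_natCast_le G k α hα).trans (lcs_antitone G ?_)
  gcongr
  simp

theorem lcs_omega_sq_le (G : Type u) [Group G] (n : ℕ) :
    lcs G (Ordinal.omega0 ^ 2) ≤ lcs G (Ordinal.omega0 * n) := by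
  refine lcs_antitone G ?_
  rw [pow_two]
  gcongr
  exact (Ordinal.natCast_lt_omega0 n).le

/-- Each β < ω² lies below some ωn, so stabilising at β would force γ_{ωn} = 1. -/
theorem isLowerCentralLength_omega_sq (G : Type u) [Group G]
    (h1 : lcs G (Ordinal.omega0 ^ 2) = ⊥) (h2 : ∀ n : ℕ, lcs G (Ordinal.omega0 * n) ≠ ⊥) :
    IsLowerCentralLength G (Ordinal.omega0 ^ 2) := by
  have hone : (1 : Ordinal.{u}) ≤ Ordinal.omega0 ^ 2 :=
    one_le_pow₀ Ordinal.one_lt_omega0.le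
  refine ⟨⟨hone, ?_⟩, ?_⟩
  · rw [lcs_add_one G hone, h1, Subgroup.commutator_bot_left]
  · rintro β ⟨hβ1, hβ⟩
    by_contra hlt
    rw [not_le] at hlt
    have hb := lcs_eq_of_stable G hβ1 hβ hlt.le
    rw [h1] at hb
    rw [pow_two, Ordinal.lt_mul_iff_of_isSuccLimit Ordinal.isSuccLimit_omega0] at hlt
    obtain ⟨c, hc, hβc⟩ := hlt
    obtain ⟨n, rfl⟩ := Ordinal.lt_omega0.1 hc
    exact h2 n (le_bot_iff.1 ((lcs_antitone G hβc.le).trans hb.ge))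

theorem not_isLowerCentralLength_omega_sq (G : Type u) [Group G] {β : Ordinal.{u}} (h1 : 1 ≤ β)
    (hlt : β < Ordinal.omega0 ^ 2) (h : lcs G β = lcs G (β + 1)) :
    ¬ IsLowerCentralLength G (Ordinal.omega0 ^ 2) :=
  fun hl => not_le_of_gt hlt (hl.2 ⟨h1, h⟩)

/-! ### Abelianization of F₂ and the matrix of φ -/

/-- The vector of exponent sums of an element of the free group of rank two. -/
def exponentHom : FreeGroup (Fin 2) →* Multiplicative (Fin 2 → ℤ) :=
  FreeGroup.lift fun i => Multiplicative.ofAdd (Pi.single i 1)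

/-- `exponentHom` with values in an additive group. -/
def exponents (g : FreeGroup (Fin 2)) : Fin 2 → ℤ := (exponentHom g).toAdd

@[simp] theorem exponents_one : exponents 1 = 0 := by simp [exponents]

@[simp] theorem exponents_mul (g h : FreeGroup (Fin 2)) :
    exponents (g * h) = exponents g + exponents h := by simp [exponents]

@[simp] theorem exponents_inv (g : FreeGroup (Fin 2)) : exponents g⁻¹ = -exponents g := by
  simp [exponents]

@[simp] theorem exponents_pow (g : FreeGroup (Fin 2)) (n : ℕ) :
    exponents (g ^ n) = n • exponents g := by simp [exponents]

@[simp] theorem exponents_zpow (g : FreeGroup (Fin 2)) (n : ℤ) :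
    exponents (g ^ n) = n • exponents g := by simp [exponents]

@[simp] theorem exponents_of (i : Fin 2) : exponents (FreeGroup.of i) = Pi.single i 1 := by
  simp [exponents, exponentHom]

theorem exponents_surjective (v : Fin 2 → ℤ) : ∃ g, exponents g = v := by
  refine ⟨FreeGroup.of 0 ^ v 0 * FreeGroup.of 1 ^ v 1, ?_⟩
  ext i
  fin_cases i <;> simp

/-- The abelianization map `q` is determined on the two generators, hence equals `r`, which depends
on the exponent sums only. -/
theorem mul_inv_mem_commutator_of_exponents_eq {g h : FreeGroup (Fin 2)}
    (e : exponents g = exponents h) : g * h⁻¹ ∈ commutator (FreeGroup (Fin 2)) := by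
  let q : FreeGroup (Fin 2) →* Abelianization (FreeGroup (Fin 2)) := Abelianization.of
  let r : FreeGroup (Fin 2) →* Abelianization (FreeGroup (Fin 2)) :=
    { toFun := fun g => q (FreeGroup.of 0) ^ exponents g 0 * q (FreeGroup.of 1) ^ exponents g 1
      map_one' := by simp
      map_mul' := fun a b => by
        simp only [exponents_mul, Pi.add_apply, zpow_add]
        exact mul_mul_mul_comm _ _ _ _ }
  have hqr : q = r := by
    ext i
    fin_cases i <;> simp [r]
  rw [← Abelianization.ker_of, MonoidHom.mem_ker]
  change q (g * h⁻¹) = 1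
  rw [map_mul, map_inv, hqr]
  simp [r, e]

/-- The matrix of the action on the abelianization. -/
def autMatrix (φ : MulAut (FreeGroup (Fin 2))) : Matrix (Fin 2) (Fin 2) ℤ :=
  Matrix.of fun i j => exponents (φ (FreeGroup.of j)) i

theorem exponents_aut (φ : MulAut (FreeGroup (Fin 2))) (g : FreeGroup (Fin 2)) :
    exponents (φ g) = (autMatrix φ).mulVec (exponents g) := by
  let r : FreeGroup (Fin 2) →* Multiplicative (Fin 2 → ℤ) :=
    { toFun := fun g => Multiplicative.ofAdd ((autMatrix φ).mulVec (exponents g))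
      map_one' := by simp
      map_mul' := fun a b => by rw [exponents_mul, Matrix.mulVec_add, ofAdd_add] }
  have h : exponentHom.comp φ.toMonoidHom = r := by
    ext i j
    change exponents (φ (FreeGroup.of i)) j =
      (autMatrix φ).mulVec (exponents (FreeGroup.of i)) j
    rw [exponents_of, Matrix.mulVec_single_one]
    rfl
  exact congrArg Multiplicative.toAdd (DFunLike.congr_fun h g)

theorem autMatrix_det (φ : MulAut (FreeGroup (Fin 2))) :
    (autMatrix φ).det = 1 ∨ (autMatrix φ).det = -1 := by
  have h : autMatrix φ * autMatrix φ⁻¹ = 1 := by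
    refine Matrix.mulVec_injective ?_
    ext1 v
    obtain ⟨g, rfl⟩ := exponents_surjective v
    rw [← Matrix.mulVec_mulVec, ← exponents_aut, ← exponents_aut]
    simp
  exact Int.isUnit_iff.1 (IsUnit.of_mul_eq_one (autMatrix φ⁻¹).det (by rw [← Matrix.det_mul, h, Matrix.det_one]))

theorem Matrix.cayleyHamilton_fin_two (M : Matrix (Fin 2) (Fin 2) ℤ) (v : Fin 2 → ℤ) :
    M.mulVec (M.mulVec v) = M.trace • M.mulVec v - M.det • v := by
  ext i
  fin_cases i <;>
    simp [Matrix.mulVec, dotProduct, Fin.sum_univ_two, Matrix.trace_fin_two,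
      Matrix.det_fin_two] <;> ring

/-! ### Terms of the series inside F₂, and case a) -/

/-- The part of a term of the lower central series of `F₂ ⋊ ℤ` that lies in `F₂`
(the index starts at `0`). -/
def fiberLCS (φ : MulAut (FreeGroup (Fin 2))) (n : ℕ) : Subgroup (FreeGroup (Fin 2)) :=
  ((⊤ : Subgroup (FreeTwoByZ φ)).lowerCentralSeries n).comap inl

theorem mem_fiberLCS {φ : MulAut (FreeGroup (Fin 2))} {n : ℕ} {g : FreeGroup (Fin 2)} :
    g ∈ fiberLCS φ n ↔ (inl g : FreeTwoByZ φ) ∈ (⊤ : Subgroup (FreeTwoByZ φ)).lowerCentralSeries n :=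
  Iff.rfl

instance (φ : MulAut (FreeGroup (Fin 2))) (n : ℕ) : (fiberLCS φ n).Normal := by
  unfold fiberLCS
  infer_instance

theorem fiberLCS_zero (φ : MulAut (FreeGroup (Fin 2))) : fiberLCS φ 0 = ⊤ := by
  simp [fiberLCS]

theorem lowerCentralSeries_top_succ (G : Type*) [Group G] (n : ℕ) :
    (⊤ : Subgroup G).lowerCentralSeries (n + 1) = ⁅(⊤ : Subgroup G).lowerCentralSeries n, ⊤⁆ := rfl

theorem commutator_mem_fiberLCS {φ : MulAut (FreeGroup (Fin 2))} {n : ℕ} {a : FreeGroup (Fin 2)}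
    (ha : a ∈ fiberLCS φ n) (f : FreeGroup (Fin 2)) : ⁅a, f⁆ ∈ fiberLCS φ (n + 1) := by
  rw [mem_fiberLCS] at *
  rw [map_commutatorElement, lowerCentralSeries_top_succ]
  exact Subgroup.commutator_mem_commutator ha (Subgroup.mem_top _)

theorem inl_aut_eq (φ : MulAut (FreeGroup (Fin 2))) (x : FreeGroup (Fin 2)) :
    (inl (φ x) : FreeTwoByZ φ) =
      (inr (Multiplicative.ofAdd 1))⁻¹ * inl x * inr (Multiplicative.ofAdd 1) :=
  (FreeTwoByZ.conj_eq φ x).symm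

/-- The element a⁻¹φ(a) is the commutator [a⁻¹, t⁻¹]; on exponent vectors this is M - 1. -/
theorem inv_mul_aut_mem_fiberLCS {φ : MulAut (FreeGroup (Fin 2))} {n : ℕ} {a : FreeGroup (Fin 2)}
    (ha : a ∈ fiberLCS φ n) : a⁻¹ * φ a ∈ fiberLCS φ (n + 1) := by
  rw [mem_fiberLCS] at *
  have : (inl (a⁻¹ * φ a) : FreeTwoByZ φ) = 
      ⁅(inl a : FreeTwoByZ φ)⁻¹, (inr (Multiplicative.ofAdd 1) : FreeTwoByZ φ)⁻¹⁆ := by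
    rw [map_mul, inl_aut_eq, commutatorElement_def]
    simp [mul_assoc]
  rw [this, lowerCentralSeries_top_succ]
  exact Subgroup.commutator_mem_commutator (inv_mem ha) (Subgroup.mem_top _)

theorem lcs_le_range_inl (φ : MulAut (FreeGroup (Fin 2))) :
    lcs (FreeTwoByZ φ) 2 ≤ (⊤ : Subgroup (FreeGroup (Fin 2))).map inl := by
  have h : lcs (FreeTwoByZ φ) 2 = _ := lcs_nat (FreeTwoByZ φ) 1
  rw [h, ← MonoidHom.range_eq_map, range_inl_eq_ker_rightHom]
  refine Subgroup.commutator_le.2 fun a _ b _ => ?_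
  rw [MonoidHom.mem_ker, map_commutatorElement, commutatorElement_eq_one_iff_commute]
  exact Commute.all _ _

/-- The hypothesis says det(1 - M) = ±1. Once a term is all of F₂, the next one contains [F₂,F₂],
and surjectivity of M - 1 on ℤ² supplies the rest. -/
theorem fiberLCS_eq_top {φ : MulAut (FreeGroup (Fin 2))}
    (h : 1 - (autMatrix φ).trace + (autMatrix φ).det = 1 ∨
      1 - (autMatrix φ).trace + (autMatrix φ).det = -1) (n : ℕ) : fiberLCS φ n = ⊤ := by
  induction n with
  | zero => exact fiberLCS_zero φ
  | succ n ih =>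
    have hc : commutator (FreeGroup (Fin 2)) ≤ fiberLCS φ (n + 1) :=
      Subgroup.commutator_le.2 fun a _ b _ => commutator_mem_fiberLCS (by rw [ih]; trivial) b
    rw [eq_top_iff]
    intro g _
    obtain ⟨s, hs⟩ : ∃ s : ℤ, s * (1 - (autMatrix φ).trace + (autMatrix φ).det) = 1 := by
      rcases h with h | h <;> rw [h]
      exacts [⟨1, by simp⟩, ⟨-1, by simp⟩]
    -- By Cayley–Hamilton, (M - 1)⁻¹ = -s(M + 1 - τ).
    obtain ⟨u, hu⟩ := exponents_surjective
      ((-s) • ((autMatrix φ).mulVec (exponents g) + (1 - (autMatrix φ).trace) • exponents g))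
    have hm : u⁻¹ * φ u ∈ fiberLCS φ (n + 1) := inv_mul_aut_mem_fiberLCS (by rw [ih]; trivial)
    have he : exponents g = exponents (u⁻¹ * φ u) := by
      rw [exponents_mul, exponents_inv, exponents_aut, hu, Matrix.mulVec_smul, Matrix.mulVec_add,
        Matrix.mulVec_smul, Matrix.cayleyHamilton_fin_two]
      ext i
      simp only [Pi.add_apply, Pi.neg_apply, Pi.smul_apply, Pi.sub_apply, smul_eq_mul]
      linear_combination (-exponents g i) * hs
    have := mul_mem (hc (mul_inv_mem_commutator_of_exponents_eq he)) hm
    rwa [inv_mul_cancel_right] at this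

theorem lcs_omega_eq_two {φ : MulAut (FreeGroup (Fin 2))}
    (h : 1 - (autMatrix φ).trace + (autMatrix φ).det = 1 ∨
      1 - (autMatrix φ).trace + (autMatrix φ).det = -1) :
    lcs (FreeTwoByZ φ) Ordinal.omega0 = lcs (FreeTwoByZ φ) 2 := by
  refine le_antisymm (lcs_omega_le _ 2) (le_lcs_omega _ fun k => ?_)
  refine (lcs_le_range_inl φ).trans ?_
  rw [lcs_nat, Subgroup.map_le_iff_le_comap]
  exact (fiberLCS_eq_top h k).ge

/-! ### Case c), lower bound: [F₂,F₂] lies in γ_ω -/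

theorem exists_mem_fiberLCS_exponents {φ : MulAut (FreeGroup (Fin 2))}
    (hdet : (autMatrix φ).det = -1) (n : ℕ) (v : Fin 2 → ℤ) :
    ∃ a ∈ fiberLCS φ n, exponents a = (autMatrix φ).trace ^ n • v := by
  induction n generalizing v with
  | zero =>
    obtain ⟨g, rfl⟩ := exponents_surjective v
    exact ⟨g, by simp [fiberLCS_zero], by simp⟩
  | succ n ih =>
    -- For det M = -1 one has (M - 1)(1 + M - τ) = τ, so each commutator with t can be made to
    -- contribute a factor τ.
    obtain ⟨a, ha, e⟩ := ih (v + (autMatrix φ).mulVec v - (autMatrix φ).trace • v)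
    refine ⟨_, inv_mul_aut_mem_fiberLCS ha, ?_⟩
    rw [exponents_mul, exponents_inv, exponents_aut, e, Matrix.mulVec_smul, Matrix.mulVec_sub,
      Matrix.mulVec_add, Matrix.mulVec_smul, Matrix.cayleyHamilton_fin_two, hdet]
    ext i
    simp only [Pi.add_apply, Pi.neg_apply, Pi.smul_apply, Pi.sub_apply, smul_eq_mul]
    ring

/-- In a class two quotient of the free group of rank two, a commutator depends only on the
determinant of the exponent sums. -/
theorem commutator_eq_zpow_of_central {Q : Type*} [Group Q] (π : FreeGroup (Fin 2) →* Q)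
    (hc : ∀ a b c : Q, Commute ⁅a, b⁆ c) (g h : FreeGroup (Fin 2)) :
    ⁅π g, π h⁆ = ⁅π (FreeGroup.of 0), π (FreeGroup.of 1)⁆ ^
      (exponents g 0 * exponents h 1 - exponents g 1 * exponents h 0) := by
  have mul_left : ∀ a b c : Q, ⁅a * b, c⁆ = ⁅a, c⁆ * ⁅b, c⁆ := fun a b c => by
    rw [commutatorElement_mul_left_eq_conj_mul, ← (hc b c a).eq]
    rw [mul_inv_cancel_right, (hc b c _).eq]
  have mul_right : ∀ a b c : Q, ⁅a, b * c⁆ = ⁅a, b⁆ * ⁅a, c⁆ := fun a b c => by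
    rw [← commutatorElement_inv, mul_left, mul_inv_rev, commutatorElement_inv,
      commutatorElement_inv, (hc a c _).eq]
  let z := ⁅π (FreeGroup.of 0), π (FreeGroup.of 1)⁆
  have hgen : ∀ (i : Fin 2) (g : FreeGroup (Fin 2)), ⁅π g, π (FreeGroup.of i)⁆ =
      z ^ (exponents g 0 * (Pi.single i 1 : Fin 2 → ℤ) 1 -
        exponents g 1 * (Pi.single i 1 : Fin 2 → ℤ) 0) := fun i g => by
    let l : FreeGroup (Fin 2) →* Q :=
      { toFun := fun g => ⁅π g, π (FreeGroup.of i)⁆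
        map_one' := by simp
        map_mul' := fun a b => by rw [map_mul, mul_left] }
    let r : FreeGroup (Fin 2) →* Q :=
      { toFun := fun g => z ^ (exponents g 0 * (Pi.single i 1 : Fin 2 → ℤ) 1 -
          exponents g 1 * (Pi.single i 1 : Fin 2 → ℤ) 0)
        map_one' := by simp
        map_mul' := fun a b => by
          rw [← zpow_add, exponents_mul, Pi.add_apply, Pi.add_apply]
          congr 1
          ring }
    have hlr : l = r := by
      ext j
      change ⁅π (FreeGroup.of j), π (FreeGroup.of i)⁆ =
        z ^ (exponents (FreeGroup.of j) 0 * (Pi.single i 1 : Fin 2 → ℤ) 1 -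
          exponents (FreeGroup.of j) 1 * (Pi.single i 1 : Fin 2 → ℤ) 0)
      fin_cases i <;> fin_cases j <;> simp [z]
    exact DFunLike.congr_fun hlr g
  let l : FreeGroup (Fin 2) →* Q :=
    { toFun := fun h => ⁅π g, π h⁆
      map_one' := by simp
      map_mul' := fun a b => by rw [map_mul, mul_right] }
  let r : FreeGroup (Fin 2) →* Q :=
    { toFun := fun h => z ^ (exponents g 0 * exponents h 1 - exponents g 1 * exponents h 0)
      map_one' := by simp
      map_mul' := fun a b => by
        rw [← zpow_add, exponents_mul, Pi.add_apply, Pi.add_apply]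
        congr 1
        ring }
  have hlr : l = r := by
    ext j
    change ⁅π g, π (FreeGroup.of j)⁆ = z ^ (exponents g 0 * exponents (FreeGroup.of j) 1 -
      exponents g 1 * exponents (FreeGroup.of j) 0)
    rw [hgen, exponents_of]
  exact DFunLike.congr_fun hlr h

theorem Subgroup.commutator_top_le_iff {G : Type*} [Group G] {H N : Subgroup G} [N.Normal] :
    ⁅H, (⊤ : Subgroup G)⁆ ≤ N ↔ H ≤ (center (G ⧸ N)).comap (QuotientGroup.mk' N) := by
  rw [commutator_le]
  refine forall₂_congr fun g _ => ?_
  rw [mem_comap, mem_center_iff, (QuotientGroup.mk'_surjective N).forall]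
  refine forall_congr' fun h => ?_
  have : ⁅g, h⁆ ∈ N ↔ ⁅QuotientGroup.mk' N g, QuotientGroup.mk' N h⁆ = 1 := by
    rw [← map_commutatorElement, QuotientGroup.mk'_apply, QuotientGroup.eq_one_iff]
  rw [this, commutatorElement_eq_one_iff_mul_comm, eq_comm]
  simp

theorem Subgroup.sup_commutator_top_le {G : Type*} [Group G] {A B N : Subgroup G} [N.Normal]
    (hA : ⁅A, (⊤ : Subgroup G)⁆ ≤ N) (hB : ⁅B, (⊤ : Subgroup G)⁆ ≤ N) :
    ⁅A ⊔ B, (⊤ : Subgroup G)⁆ ≤ N := by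
  rw [commutator_top_le_iff] at *
  exact sup_le hA hB

section

variable {φ : MulAut (FreeGroup (Fin 2))}

theorem aut_mem_lowerCentralSeries {G : Type*} [Group G] (φ : MulAut G) {n : ℕ} {g : G}
    (hg : g ∈ (⊤ : Subgroup G).lowerCentralSeries n) :
    φ g ∈ (⊤ : Subgroup G).lowerCentralSeries n := by
  have h := Subgroup.mem_map_of_mem φ.toMonoidHom hg
  rw [Subgroup.map_lowerCentralSeries] at h
  exact Subgroup.lowerCentralSeries_mono n le_top h

/-- Modulo the third term of F₂, φ inverts c = [x,y] because det M = -1, so commuting with t doubles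
the exponent and c^(2^n) is reached. Bracketing y with an element of exponents (τ^n, 0) gives
c^(τ^n). For odd τ the two exponents are coprime. -/
theorem commutatorElement_mem_fiberLCS_sup (hdet : (autMatrix φ).det = -1)
    (htr : Odd (autMatrix φ).trace) (n : ℕ) :
    ⁅FreeGroup.of (0 : Fin 2), FreeGroup.of (1 : Fin 2)⁆ ∈
      fiberLCS φ n ⊔ (⊤ : Subgroup (FreeGroup (Fin 2))).lowerCentralSeries 2 := by
  let c : FreeGroup (Fin 2) := ⁅FreeGroup.of (0 : Fin 2), FreeGroup.of (1 : Fin 2)⁆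
  let B : ℕ → Subgroup (FreeGroup (Fin 2)) :=
    fun n => fiberLCS φ n ⊔ (⊤ : Subgroup (FreeGroup (Fin 2))).lowerCentralSeries 2
  have hcent : ∀ (n : ℕ) (a b c : FreeGroup (Fin 2) ⧸ B n), Commute ⁅a, b⁆ c := by
    intro n a b c
    obtain ⟨a, rfl⟩ := QuotientGroup.mk'_surjective _ a
    obtain ⟨b, rfl⟩ := QuotientGroup.mk'_surjective _ b
    obtain ⟨c, rfl⟩ := QuotientGroup.mk'_surjective _ c
    rw [← commutatorElement_eq_one_iff_commute, ← map_commutatorElement, ← map_commutatorElement,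
      QuotientGroup.mk'_apply, QuotientGroup.eq_one_iff]
    refine le_sup_right (a := fiberLCS φ n) ?_
    exact Subgroup.commutator_mem_commutator (Subgroup.commutator_mem_commutator
      (Subgroup.mem_top _) (Subgroup.mem_top _)) (Subgroup.mem_top _)
  have one_iff : ∀ (n : ℕ) (g : FreeGroup (Fin 2)), QuotientGroup.mk' (B n) g = 1 ↔ g ∈ B n :=
    fun n g => by rw [QuotientGroup.mk'_apply, QuotientGroup.eq_one_iff]
  have h2 : ∀ n : ℕ, c ^ 2 ^ n ∈ B n := by
    intro n
    induction n with
    | zero => simp [B, fiberLCS_zero]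
    | succ n ih =>
      obtain ⟨a, ha, s, hs, e⟩ := Subgroup.mem_sup_of_normal_right.1 ih
      let π := QuotientGroup.mk' (B (n + 1))
      have hs1 : π s = 1 := (one_iff _ _).2 (le_sup_right (a := fiberLCS φ (n + 1)) hs)
      have hs2 : π (φ s) = 1 := (one_iff _ _).2
        (le_sup_right (a := fiberLCS φ (n + 1)) (aut_mem_lowerCentralSeries φ hs))
      have ha1 : π (a⁻¹ * φ a) = 1 :=
        (one_iff _ _).2 (le_sup_left (b := Subgroup.lowerCentralSeries _ 2)
          (inv_mul_aut_mem_fiberLCS ha))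
      have hφc : π (φ c) = (π c)⁻¹ := by
        have : (autMatrix φ).det = exponents (φ (FreeGroup.of 0)) 0 *
            exponents (φ (FreeGroup.of 1)) 1 - exponents (φ (FreeGroup.of 0)) 1 *
            exponents (φ (FreeGroup.of 1)) 0 := by
          rw [Matrix.det_fin_two]
          simp only [autMatrix, Matrix.of_apply]
          ring
        change π (φ ⁅FreeGroup.of (0 : Fin 2), FreeGroup.of (1 : Fin 2)⁆) =
          (π ⁅FreeGroup.of (0 : Fin 2), FreeGroup.of (1 : Fin 2)⁆)⁻¹
        rw [map_commutatorElement, map_commutatorElement,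
          commutator_eq_zpow_of_central π (hcent _), ← this, hdet, zpow_neg_one,
          map_commutatorElement]
      have e1 : π c ^ 2 ^ n = π a := by rw [← map_pow, ← e, map_mul, hs1, mul_one]
      have e2 : ((π c)⁻¹) ^ 2 ^ n = π a := by
        rw [← hφc, ← map_pow, ← map_pow, ← e, map_mul, map_mul, hs2, mul_one]
        rw [map_mul, map_inv, inv_mul_eq_one] at ha1
        exact ha1.symm
      rw [← one_iff]
      change π _ = 1
      rw [map_pow, pow_succ, mul_two, pow_add]
      nth_rw 2 [e1]
      rw [← e2, inv_pow, mul_inv_cancel]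
  have h3 : c ^ (autMatrix φ).trace ^ n ∈ B n := by
    obtain ⟨a, ha, e⟩ := exists_mem_fiberLCS_exponents hdet n (Pi.single 0 1)
    let π := QuotientGroup.mk' (B n)
    have hπ : π ⁅a, FreeGroup.of (1 : Fin 2)⁆ = 1 := by
      refine (one_iff _ _).2 (le_sup_left (b := Subgroup.lowerCentralSeries _ 2) ?_)
      rw [commutatorElement_def, mul_assoc, mul_assoc]
      refine mul_mem ha ?_
      rw [← mul_assoc]
      exact (inferInstance : (fiberLCS φ n).Normal).conj_mem _ (inv_mem ha) _
    rw [map_commutatorElement, commutator_eq_zpow_of_central π (hcent _), e, exponents_of,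
      ← map_commutatorElement, ← map_zpow, one_iff] at hπ
    simpa using hπ
  have hcop : IsCoprime ((autMatrix φ).trace ^ n) ((2 : ℤ) ^ n) := by
    refine IsCoprime.pow ?_
    obtain ⟨k, hk⟩ := htr
    exact ⟨1, -k, by rw [hk]; ring⟩
  obtain ⟨u, v, huv⟩ := hcop
  have := mul_mem (zpow_mem h3 u) (zpow_mem (h2 n) v)
  rw [← zpow_mul, ← zpow_natCast c, ← zpow_mul, ← zpow_add] at this
  push_cast at this
  rw [mul_comm _ u, mul_comm _ v, huv, zpow_one] at this
  exact this

/-- The inclusion Γ_2 ≤ γ_n Γ_3 propagates along the series of F₂ by bracketing, until the last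
factor is itself inside γ_n. In the code, `Γ` is indexed from 0. -/
theorem commutator_le_fiberLCS (hdet : (autMatrix φ).det = -1)
    (htr : Odd (autMatrix φ).trace) (n : ℕ) : commutator (FreeGroup (Fin 2)) ≤ fiberLCS φ n := by
  let Γ : ℕ → Subgroup (FreeGroup (Fin 2)) := (⊤ : Subgroup (FreeGroup (Fin 2))).lowerCentralSeries
  have h1 : Γ 1 ≤ fiberLCS φ n ⊔ Γ 2 := by
    refine Subgroup.commutator_le.2 fun a _ b _ => ?_
    let π := QuotientGroup.mk' (fiberLCS φ n ⊔ Γ 2)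
    have one_iff : ∀ g, π g = 1 ↔ g ∈ fiberLCS φ n ⊔ Γ 2 :=
      fun g => by rw [QuotientGroup.mk'_apply, QuotientGroup.eq_one_iff]
    have hcent : ∀ a b c : FreeGroup (Fin 2) ⧸ (fiberLCS φ n ⊔ Γ 2), Commute ⁅a, b⁆ c := by
      intro a b c
      obtain ⟨a, rfl⟩ := QuotientGroup.mk'_surjective _ a
      obtain ⟨b, rfl⟩ := QuotientGroup.mk'_surjective _ b
      obtain ⟨c, rfl⟩ := QuotientGroup.mk'_surjective _ c
      rw [← commutatorElement_eq_one_iff_commute, ← map_commutatorElement,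
        ← map_commutatorElement, one_iff]
      refine le_sup_right (a := fiberLCS φ n) ?_
      exact Subgroup.commutator_mem_commutator (Subgroup.commutator_mem_commutator
        (Subgroup.mem_top _) (Subgroup.mem_top _)) (Subgroup.mem_top _)
    rw [← one_iff, map_commutatorElement, commutator_eq_zpow_of_central π hcent,
      ← map_commutatorElement, (one_iff _).2 (commutatorElement_mem_fiberLCS_sup hdet htr n),
      one_zpow]
  have h2 : ∀ j, Γ (j + 1) ≤ fiberLCS φ n ⊔ Γ (j + 2) := by
    intro j
    induction j with
    | zero => exact h1
    | succ j ih =>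
      refine (Subgroup.commutator_mono ih le_rfl).trans ?_
      refine Subgroup.sup_commutator_top_le ?_ le_sup_right
      exact (Subgroup.commutator_le_left _ _).trans le_sup_left
  have h3 : ∀ j, Γ 1 ≤ fiberLCS φ n ⊔ Γ (j + 1) := by
    intro j
    induction j with
    | zero => exact le_sup_right
    | succ j ih => exact ih.trans (sup_le le_sup_left (h2 j))
  have h4 : ∀ j, Γ j ≤ fiberLCS φ j := by
    intro j
    induction j with
    | zero => rw [fiberLCS_zero]; exact le_top
    | succ j ih =>
      exact Subgroup.commutator_le.2 fun a ha b _ => commutator_mem_fiberLCS (ih ha) b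
  refine (h3 n).trans (sup_le le_rfl ?_)
  exact (Subgroup.lowerCentralSeries_antitone _ n.le_succ).trans (h4 n)

theorem map_commutator_le_lcs_omega (hdet : (autMatrix φ).det = -1)
    (htr : Odd (autMatrix φ).trace) :
    (commutator (FreeGroup (Fin 2))).map inl ≤ lcs (FreeTwoByZ φ) Ordinal.omega0 := by
  refine le_lcs_omega _ fun k => ?_
  rw [lcs_nat, Subgroup.map_le_iff_le_comap]
  exact commutator_le_fiberLCS hdet htr k

theorem lcs_omega_mul_ne_bot (hdet : (autMatrix φ).det = -1)
    (htr : Odd (autMatrix φ).trace) (n : ℕ) :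
    lcs (FreeTwoByZ φ) (Ordinal.omega0 * n) ≠ ⊥ := by
  -- In S₄ the image of [x, y²] is a double transposition and that of [x,y] a 3-cycle. Bracketing
  -- with the 3-cycle permutes the three double transpositions `V` among themselves, so repeated
  -- brackets with [x,y] ∈ γ_ω never become trivial.
  let σ : FreeGroup (Fin 2) →* Equiv.Perm (Fin 4) :=
    FreeGroup.lift ![Equiv.swap 0 1, finRotate 4]
  let x : FreeGroup (Fin 2) := FreeGroup.of 0
  let y : FreeGroup (Fin 2) := FreeGroup.of 1
  have hmem : ∀ a b : FreeGroup (Fin 2), (inl ⁅a, b⁆ : FreeTwoByZ φ) ∈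
      (commutator (FreeGroup (Fin 2))).map inl := fun a b =>
    Subgroup.mem_map_of_mem _ (Subgroup.commutator_mem_commutator (Subgroup.mem_top _)
      (Subgroup.mem_top _))
  let V : Finset (Equiv.Perm (Fin 4)) := {Equiv.swap 0 1 * Equiv.swap 2 3,
    Equiv.swap 0 2 * Equiv.swap 1 3, Equiv.swap 0 3 * Equiv.swap 1 2}
  have key : ∀ n : ℕ, ∃ g : FreeGroup (Fin 2), σ g ∈ V ∧
      (inl g : FreeTwoByZ φ) ∈ lcs (FreeTwoByZ φ) (Ordinal.omega0 * (n + 1 : ℕ)) := by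
    intro n
    induction n with
    | zero =>
      refine ⟨⁅x, y ^ 2⁆, ?_, ?_⟩
      · simp only [σ, x, y, map_commutatorElement, map_pow, FreeGroup.lift_apply_of]
        decide
      · rw [zero_add, Nat.cast_one, mul_one]
        exact map_commutator_le_lcs_omega hdet htr (hmem x (y ^ 2))
    | succ n ih =>
      obtain ⟨g, hg, hgm⟩ := ih
      refine ⟨⁅g, ⁅x, y⁆⁆, ?_, ?_⟩
      · have : ∀ v ∈ V, ⁅v, ⁅(Equiv.swap 0 1 : Equiv.Perm (Fin 4)), finRotate 4⁆⁆ ∈ V := by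
          intro v hv
          simp only [V, Finset.mem_insert, Finset.mem_singleton] at hv
          rcases hv with rfl | rfl | rfl <;> decide
        have h := this _ hg
        simp only [σ, x, y, map_commutatorElement, FreeGroup.lift_apply_of] at h ⊢
        exact h
      · rw [Nat.cast_succ (n + 1), mul_add, mul_one, map_commutatorElement]
        refine lcs_commutator_omega_le _ ?_ le_rfl (map_commutator_le_lcs_omega hdet htr)
          (Subgroup.commutator_mem_commutator hgm (hmem x y))
        refine Ordinal.one_lt_omega0.le.trans ?_
        exact Ordinal.le_mul_left _ (by simp)
  intro h
  obtain ⟨g, hg, hgm⟩ := key n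
  have h' := lcs_antitone (FreeTwoByZ φ)
    (show Ordinal.omega0 * (n : Ordinal) ≤ Ordinal.omega0 * (n + 1 : ℕ) by gcongr; simp) hgm
  rw [h, Subgroup.mem_bot, map_eq_one_iff _ inl_injective] at h'
  rw [h', map_one] at hg
  revert hg
  decide

end

/-! ### Group ring filtrations and congruence subgroups -/

section GroupRing

variable {R : Type*} [CommRing R]

/-- The augmentation of the group ring of the free group of rank two. -/
noncomputable def augmentation (R : Type*) [CommRing R] :
    MonoidAlgebra R (FreeGroup (Fin 2)) →ₐ[R] R :=
  MonoidAlgebra.lift R R (FreeGroup (Fin 2)) 1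

/-- Elements of the group ring whose augmentation is divisible by `r`. -/
noncomputable def augIdeal (r : R) : Submodule R (MonoidAlgebra R (FreeGroup (Fin 2))) :=
  Submodule.comap (augmentation R).toLinearMap (Ideal.span {r})

/-- The element `g - 1` of the group ring. -/
noncomputable def delta (R : Type*) [CommRing R] (g : FreeGroup (Fin 2)) :
    MonoidAlgebra R (FreeGroup (Fin 2)) := MonoidAlgebra.of R _ g - 1

theorem mem_augIdeal {r : R} {u : MonoidAlgebra R (FreeGroup (Fin 2))} :
    u ∈ augIdeal r ↔ r ∣ augmentation R u := Ideal.mem_span_singleton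

@[simp] theorem augmentation_of (g : FreeGroup (Fin 2)) :
    augmentation R (MonoidAlgebra.of R _ g) = 1 := by
  simp [augmentation]

@[simp] theorem augmentation_delta (g : FreeGroup (Fin 2)) :
    augmentation R (delta R g) = 0 := by
  simp only [delta, map_sub, augmentation_of, map_one, sub_self]

theorem delta_mem_augIdeal (r : R) (g : FreeGroup (Fin 2)) : delta R g ∈ augIdeal r := by
  simp [mem_augIdeal]

theorem mul_mem_augIdeal_right {r : R} {u : MonoidAlgebra R (FreeGroup (Fin 2))}
    (hu : u ∈ augIdeal r) (v : MonoidAlgebra R (FreeGroup (Fin 2))) : u * v ∈ augIdeal r := by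
  rw [mem_augIdeal] at *
  rw [map_mul]
  exact hu.mul_right _

theorem mul_mem_augIdeal_pow {r : R} {m n : ℕ} {u v : MonoidAlgebra R (FreeGroup (Fin 2))}
    (hu : u ∈ augIdeal r ^ m) (hv : v ∈ augIdeal r ^ n) : u * v ∈ augIdeal r ^ (m + n) := by
  rw [pow_add]
  exact Submodule.mul_mem_mul hu hv

theorem mul_mem_augIdeal_pow_succ {r : R} {n : ℕ} {u v : MonoidAlgebra R (FreeGroup (Fin 2))}
    (hu : u ∈ augIdeal r) (hv : v ∈ augIdeal r ^ n) : u * v ∈ augIdeal r ^ (n + 1) := by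
  rw [pow_succ']
  exact Submodule.mul_mem_mul hu hv

theorem mul_mem_augIdeal_pow_succ' {r : R} {n : ℕ} {u v : MonoidAlgebra R (FreeGroup (Fin 2))}
    (hu : u ∈ augIdeal r ^ n) (hv : v ∈ augIdeal r) : u * v ∈ augIdeal r ^ (n + 1) := by
  rw [pow_succ]
  exact Submodule.mul_mem_mul hu hv

/-- The exponent is n + 1 because the zeroth power of a submodule is the scalars, which absorb no
multiplication. -/
theorem mul_mem_pow_of_left {r : R} {n : ℕ} {u : MonoidAlgebra R (FreeGroup (Fin 2))}
    (hu : u ∈ augIdeal r ^ (n + 1)) (v : MonoidAlgebra R (FreeGroup (Fin 2))) :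
    u * v ∈ augIdeal r ^ (n + 1) := by
  rw [pow_succ] at *
  induction hu using Submodule.mul_induction_on' with
  | mem_mul_mem a ha b hb =>
    rw [mul_assoc]
    exact Submodule.mul_mem_mul ha (mul_mem_augIdeal_right hb v)
  | add a _ b _ h1 h2 => rw [add_mul]; exact add_mem h1 h2

theorem augIdeal_pow_succ_le (r : R) (n : ℕ) :
    augIdeal r ^ (n + 2) ≤ augIdeal r ^ (n + 1) := by
  intro u hu
  rw [pow_succ] at hu
  induction hu using Submodule.mul_induction_on' with
  | mem_mul_mem a ha b hb => exact mul_mem_pow_of_left ha b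
  | add a _ b _ h1 h2 => exact add_mem h1 h2

theorem delta_mul (g h : FreeGroup (Fin 2)) :
    delta R (g * h) = delta R g * delta R h + delta R g + delta R h := by
  simp only [delta, map_mul]
  noncomm_ring

theorem delta_one : delta R 1 = 0 := by simp [delta, MonoidAlgebra.one_def]

theorem delta_inv (g : FreeGroup (Fin 2)) :
    delta R g⁻¹ = -delta R g - delta R g⁻¹ * delta R g := by
  have h := delta_mul (R := R) g⁻¹ g
  rw [inv_mul_cancel, delta_one] at h
  rw [eq_sub_iff_add_eq, eq_neg_iff_add_eq_zero, h]
  abel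

theorem delta_conj (f g : FreeGroup (Fin 2)) :
    delta R (f * g * f⁻¹) = delta R f * delta R g * MonoidAlgebra.of R _ f⁻¹ +
      delta R g * delta R f⁻¹ + delta R g := by
  have h : MonoidAlgebra.of R (FreeGroup (Fin 2)) f * MonoidAlgebra.of R _ f⁻¹ = 1 := by
    rw [← map_mul, mul_inv_cancel, map_one]
  simp only [delta, map_mul]
  have : ∀ a b c : MonoidAlgebra R (FreeGroup (Fin 2)), a * c = 1 →
      a * b * c - 1 = (a - 1) * (b - 1) * c + (b - 1) * (c - 1) + (b - 1) := by
    intro a b c h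
    have : (a - 1) * (b - 1) * c = a * b * c - a * c - b * c + c := by noncomm_ring
    rw [this, h]
    noncomm_ring
  exact this _ _ _ h

theorem delta_commutator (g f : FreeGroup (Fin 2)) :
    delta R ⁅g, f⁆ = (delta R g * delta R f - delta R f * delta R g) *
      MonoidAlgebra.of R _ (g⁻¹ * f⁻¹) := by
  have h : delta R g * delta R f - delta R f * delta R g =
      MonoidAlgebra.of R _ (g * f) - MonoidAlgebra.of R _ (f * g) := by
    simp only [delta, map_mul]
    noncomm_ring
  rw [h, sub_mul, ← map_mul, ← map_mul, commutatorElement_def, delta]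
  simp [mul_assoc, MonoidAlgebra.one_def]

theorem delta_inv_mul (g h : FreeGroup (Fin 2)) :
    delta R (g⁻¹ * h) = delta R g⁻¹ * (delta R h - delta R g) + (delta R h - delta R g) := by
  have e : MonoidAlgebra.of R (FreeGroup (Fin 2)) g⁻¹ * MonoidAlgebra.of R _ g = 1 := by
    rw [← map_mul, inv_mul_cancel, map_one]
  simp only [delta, map_mul, sub_mul, mul_sub, one_mul, mul_one, e]
  abel

/-- The congruence subgroup of the free group attached to a submodule between two consecutive
powers of `augIdeal r`. -/
def congruenceSubgroup {r : R} {k : ℕ} (U : Submodule R (MonoidAlgebra R (FreeGroup (Fin 2))))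
    (h1 : augIdeal r ^ (k + 2) ≤ U) (h2 : U ≤ augIdeal r ^ (k + 1)) :
    Subgroup (FreeGroup (Fin 2)) where
  carrier := {g | delta R g ∈ U}
  one_mem' := by
    change delta R 1 ∈ U
    rw [delta_one]
    exact zero_mem _
  mul_mem' := by
    intro a b ha hb
    change delta R (a * b) ∈ U
    -- The product term lies in J · J^{k+1} ≤ U, so g ↦ g - 1 is additive on this layer.
    rw [delta_mul]
    exact add_mem (add_mem (h1 (mul_mem_augIdeal_pow_succ (delta_mem_augIdeal r a) (h2 hb))) ha) hb
  inv_mem' := by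
    intro a ha
    change delta R a⁻¹ ∈ U
    rw [delta_inv]
    exact sub_mem (neg_mem ha)
      (h1 (mul_mem_augIdeal_pow_succ (delta_mem_augIdeal r a⁻¹) (h2 ha)))

theorem mem_congruenceSubgroup {r : R} {k : ℕ}
    {U : Submodule R (MonoidAlgebra R (FreeGroup (Fin 2)))}
    {h1 : augIdeal r ^ (k + 2) ≤ U} {h2 : U ≤ augIdeal r ^ (k + 1)} {g : FreeGroup (Fin 2)} :
    g ∈ congruenceSubgroup U h1 h2 ↔ delta R g ∈ U := Iff.rfl

instance {r : R} {k : ℕ} (U : Submodule R (MonoidAlgebra R (FreeGroup (Fin 2))))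
    (h1 : augIdeal r ^ (k + 2) ≤ U) (h2 : U ≤ augIdeal r ^ (k + 1)) :
    (congruenceSubgroup U h1 h2).Normal where
  conj_mem g hg f := by
    rw [mem_congruenceSubgroup] at *
    rw [delta_conj]
    refine add_mem (add_mem (h1 ?_) (h1 ?_)) hg
    · exact mul_mem_pow_of_left (mul_mem_augIdeal_pow_succ (delta_mem_augIdeal r f) (h2 hg)) _
    · exact mul_mem_augIdeal_pow_succ' (h2 hg) (delta_mem_augIdeal r _)

/-- The automorphism of the group ring induced by an automorphism of the group. -/
noncomputable def autAlg (R : Type*) [CommRing R] (φ : MulAut (FreeGroup (Fin 2))) :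
    MonoidAlgebra R (FreeGroup (Fin 2)) ≃ₐ[R] MonoidAlgebra R (FreeGroup (Fin 2)) :=
  MonoidAlgebra.domCongr R R φ

@[simp] theorem autAlg_of (φ : MulAut (FreeGroup (Fin 2))) (g : FreeGroup (Fin 2)) :
    autAlg R φ (MonoidAlgebra.of R _ g) = MonoidAlgebra.of R _ (φ g) := by
  simp [autAlg]

theorem autAlg_delta (φ : MulAut (FreeGroup (Fin 2))) (g : FreeGroup (Fin 2)) :
    autAlg R φ (delta R g) = delta R (φ g) := by
  simp only [delta, map_sub, map_one, autAlg_of]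

theorem augmentation_autAlg (φ : MulAut (FreeGroup (Fin 2)))
    (u : MonoidAlgebra R (FreeGroup (Fin 2))) :
    augmentation R (autAlg R φ u) = augmentation R u := by
  have : (augmentation R).comp (autAlg R φ).toAlgHom = augmentation R := by
    ext g
    all_goals simp [autAlg, augmentation]
  exact DFunLike.congr_fun this u

theorem autAlg_mem_pow_iff {r : R} (φ : MulAut (FreeGroup (Fin 2))) (k : ℕ)
    {u : MonoidAlgebra R (FreeGroup (Fin 2))} :
    autAlg R φ u ∈ augIdeal r ^ k ↔ u ∈ augIdeal r ^ k := by
  have h : (augIdeal r).map (autAlg R φ).toAlgHom.toLinearMap = augIdeal r := by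
    ext u
    rw [Submodule.mem_map]
    constructor
    · rintro ⟨v, hv, rfl⟩
      rw [mem_augIdeal] at *
      exact (augmentation_autAlg φ v).symm ▸ hv
    · intro hu
      obtain ⟨v, rfl⟩ := (autAlg R φ).surjective u
      rw [mem_augIdeal, augmentation_autAlg] at hu
      exact ⟨v, mem_augIdeal.2 hu, rfl⟩
  have h' : (augIdeal r ^ k).map (autAlg R φ).toAlgHom.toLinearMap = augIdeal r ^ k := by
    rw [Submodule.map_pow, h]
  conv_lhs => rw [← h']
  rw [Submodule.mem_map]
  constructor
  · rintro ⟨v, hv, e⟩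
    rwa [← (autAlg R φ).injective e]
  · exact fun hu => ⟨u, hu, rfl⟩

end GroupRing

/-! ### Commutators in F₂ ⋊ ℤ -/

section Semidirect

variable {φ : MulAut (FreeGroup (Fin 2))}

theorem FreeTwoByZ.eq_inl_mul_zpow (x : FreeTwoByZ φ) :
    x = inl x.left * ((inr (Multiplicative.ofAdd 1))⁻¹) ^ (-x.right.toAdd) := by
  rw [zpow_neg, inv_zpow, inv_inv, ← map_zpow, ← ofAdd_zsmul, smul_eq_mul, mul_one]
  exact (inl_left_mul_inr_right x).symm

theorem map_inl_normal {E : Subgroup (FreeGroup (Fin 2))} [hE : E.Normal]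
    (h : ∀ g, φ g ∈ E ↔ g ∈ E) : (E.map (inl : _ →* FreeTwoByZ φ)).Normal := by
  rw [← Subgroup.normalizer_eq_top_iff, eq_top_iff]
  intro x _
  rw [FreeTwoByZ.eq_inl_mul_zpow x]
  refine mul_mem ?_ (zpow_mem ?_ _)
  · rw [Subgroup.mem_normalizer_iff]
    intro y
    constructor
    · rintro ⟨g, hg, rfl⟩
      exact ⟨_, hE.conj_mem g hg x.left, by simp⟩
    · rintro ⟨g, hg, e⟩
      refine ⟨_, hE.conj_mem g hg x.left⁻¹, ?_⟩
      rw [map_mul, map_mul, e]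
      simp [mul_assoc]
  · rw [Subgroup.mem_normalizer_iff]
    intro y
    rw [inv_inv]
    constructor
    · rintro ⟨g, hg, rfl⟩
      exact ⟨_, (h g).2 hg, inl_aut_eq φ g⟩
    · rintro ⟨g, hg, e⟩
      obtain ⟨g, rfl⟩ := φ.surjective g
      refine ⟨g, (h g).1 hg, ?_⟩
      rw [inl_aut_eq] at e
      exact mul_left_cancel (mul_right_cancel e)

/-- Centrality modulo E' need only be tested against F₂ and t⁻¹, which generate the group. -/
theorem commutator_map_inl_le {E E' : Subgroup (FreeGroup (Fin 2))} [hE' : E'.Normal]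
    (h : ∀ g, φ g ∈ E' ↔ g ∈ E') (h1 : ∀ g ∈ E, ∀ f, ⁅g, f⁆ ∈ E')
    (h2 : ∀ g ∈ E, g⁻¹ * φ g ∈ E') :
    ⁅E.map (inl : _ →* FreeTwoByZ φ), (⊤ : Subgroup (FreeTwoByZ φ))⁆ ≤ E'.map inl := by
  have := map_inl_normal h
  rw [Subgroup.commutator_top_le_iff]
  rintro _ ⟨g, hg, rfl⟩
  rw [Subgroup.mem_comap, Subgroup.mem_center_iff]
  intro x
  obtain ⟨x, rfl⟩ := QuotientGroup.mk'_surjective _ x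
  change Commute _ _
  have key : ∀ y : FreeTwoByZ φ, ⁅y, inl g⁆ ∈ E'.map inl →
      Commute (QuotientGroup.mk' (E'.map (inl : _ →* FreeTwoByZ φ)) y)
        (QuotientGroup.mk' (E'.map (inl : _ →* FreeTwoByZ φ)) (inl g)) := fun y hy => by
    rwa [← commutatorElement_eq_one_iff_commute, ← map_commutatorElement,
      QuotientGroup.mk'_apply, QuotientGroup.eq_one_iff]
  rw [FreeTwoByZ.eq_inl_mul_zpow x, map_mul, map_zpow]
  refine Commute.mul_left (key _ ?_) (Commute.zpow_left (key _ ?_) _)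
  · refine ⟨⁅x.left, g⁆, ?_, map_commutatorElement _ _ _⟩
    rw [SetLike.mem_coe, ← inv_mem_iff, commutatorElement_inv]
    exact h1 g hg _
  · refine ⟨φ g * g⁻¹, hE'.mem_comm (h2 g hg), ?_⟩
    rw [map_mul, inl_aut_eq, commutatorElement_def, inv_inv]
    simp only [map_inv (inl : _ →* FreeTwoByZ φ)]

/-- Brackets with F₂ fall into J^{k+2} automatically, so a step of the series on this layer is
governed by φ - 1 alone. -/
theorem commutator_congruenceSubgroup_le {R : Type*} [CommRing R] {r : R} {k : ℕ}
    {U U' : Submodule R (MonoidAlgebra R (FreeGroup (Fin 2)))}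
    (h1 : augIdeal r ^ (k + 2) ≤ U) (h2 : U ≤ augIdeal r ^ (k + 1))
    (h1' : augIdeal r ^ (k + 2) ≤ U') (h2' : U' ≤ augIdeal r ^ (k + 1))
    (hφ : ∀ u, autAlg R φ u ∈ U' ↔ u ∈ U') (h : ∀ u ∈ U, autAlg R φ u - u ∈ U') :
    ⁅(congruenceSubgroup U h1 h2).map (inl : _ →* FreeTwoByZ φ), (⊤ : Subgroup (FreeTwoByZ φ))⁆ ≤
      (congruenceSubgroup U' h1' h2').map inl := by
  apply commutator_map_inl_le
  · intro g
    rw [mem_congruenceSubgroup, mem_congruenceSubgroup, ← autAlg_delta, hφ]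
  · intro g hg f
    rw [mem_congruenceSubgroup] at *
    rw [delta_commutator]
    refine h1' (mul_mem_pow_of_left (sub_mem ?_ ?_) _)
    · exact mul_mem_augIdeal_pow_succ' (h2 hg) (delta_mem_augIdeal r f)
    · exact mul_mem_augIdeal_pow_succ (delta_mem_augIdeal r f) (h2 hg)
  · intro g hg
    rw [mem_congruenceSubgroup] at *
    have hd := h _ hg
    rw [autAlg_delta] at hd
    rw [delta_inv_mul]
    exact add_mem (h1' (mul_mem_augIdeal_pow_succ (delta_mem_augIdeal r _) (h2' hd))) hd

end Semidirect

/-! ### A free matrix group separating the powers of J -/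

section Sanov

open scoped Pointwise Function in
/-- Ping-pong for cyclic groups. -/
theorem FreeGroup.injective_lift_of_ping_pong_zpow {ι G α : Type*} [Nontrivial ι] [Group G]
    [MulAction G α] (a : ι → G) (X : ι → Set α) (hne : ∀ i, (X i).Nonempty)
    (hdisj : Pairwise (Disjoint on X))
    (hpp : Pairwise fun i j => ∀ n : ℤ, n ≠ 0 → a i ^ n • X j ⊆ X i) :
    Function.Injective (FreeGroup.lift a) := by
  have : FreeGroup.lift a =
      (Monoid.CoprodI.lift fun i => FreeGroup.lift fun _ => a i).comp
        (@freeGroupEquivCoprodI ι).toMonoidHom := by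
    ext i
    simp
  rw [this, MonoidHom.coe_comp]
  refine Function.Injective.comp ?_ (MulEquiv.injective freeGroupEquivCoprodI)
  refine Monoid.CoprodI.lift_injective_of_ping_pong
    (fun i : ι => (FreeGroup.lift fun _ : Unit => a i)) ?_ X hne hdisj ?_
  · inhabit ι
    -- The ping-pong lemma wants three factors, or one factor with at least three elements; an
    -- infinite cyclic factor serves.
    refine Or.inr ⟨default, ?_⟩
    rw [FreeGroup.freeGroupUnitEquivInt.cardinal_eq, Cardinal.mk_denumerable]
    exact Cardinal.natCast_le_aleph0
  · intro i j hij
    refine FreeGroup.freeGroupUnitEquivInt.forall_congr_left.mpr ?_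
    intro n hn
    have hn0 : n ≠ 0 := by
      rintro rfl
      apply hn
      simp [FreeGroup.freeGroupUnitEquivInt]
    change FreeGroup.lift (fun _ => a i) (FreeGroup.of () ^ n) • X j ⊆ X i
    rw [map_zpow, FreeGroup.lift_apply_of]
    exact hpp hij n hn0

open ModularGroup MatrixGroups

/-- The representation of the free group by the elementary matrices with entry `m`. -/
def sanov (m : ℤ) : FreeGroup (Fin 2) →* SL(2, ℤ) :=
  FreeGroup.lift ![T ^ m, S * T ^ (-m) * S⁻¹]

theorem coe_S_mul_T_zpow_mul_S_inv (n : ℤ) :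
    ((S * T ^ (-n) * S⁻¹ : SL(2, ℤ)) : Matrix (Fin 2) (Fin 2) ℤ) = !![1, 0; n, 1] := by
  ext i j
  rw [Matrix.SpecialLinearGroup.coe_mul, Matrix.SpecialLinearGroup.coe_mul, coe_T_zpow,
    Matrix.SpecialLinearGroup.coe_inv, coe_S]
  fin_cases i <;> fin_cases j <;> simp [Matrix.mul_apply, Matrix.adjugate_fin_two]

open scoped Pointwise Function in
-- Ping-pong on the regions |v₁| < |v₀| and |v₀| < |v₁|: if |a| < |b| and n ≠ 0, then |a + mnb| ≥
-- 2|b| - |a| > |b|.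
theorem sanov_injective {m : ℤ} (hm : 2 ≤ m) : Function.Injective (sanov m) := by
  let X : Fin 2 → Set (Fin 2 → ℤ) := ![{v | |v 1| < |v 0|}, {v | |v 0| < |v 1|}]
  have h : Function.Injective (FreeGroup.lift
      (fun i => Matrix.SpecialLinearGroup.toLin'
        ((![T ^ m, S * T ^ (-m) * S⁻¹] : Fin 2 → SL(2, ℤ)) i))) := by
    have key : ∀ n a b : ℤ, n ≠ 0 → |a| < |b| → |b| < |a + m * n * b| := by
      intro n a b hn hab
      have h1 : |m * n * b| ≤ |a + m * n * b| + |a| := by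
        have := abs_sub (a + m * n * b) a
        simpa using this
      have h2 : 2 * |b| ≤ |m * n * b| := by
        rw [abs_mul, abs_mul]
        have h3 : 1 ≤ |n| := Int.one_le_abs hn
        have h4 : 2 ≤ |m| := hm.trans (le_abs_self m)
        have : 2 ≤ |m| * |n| := by nlinarith
        nlinarith [abs_nonneg b]
      omega
    refine FreeGroup.injective_lift_of_ping_pong_zpow _ X ?_ ?_ ?_
    · intro i
      fin_cases i
      · exact ⟨![1, 0], by simp [X]⟩
      · exact ⟨![0, 1], by simp [X]⟩
    · intro i j hij
      rw [Function.onFun, Set.disjoint_left]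
      intro v
      fin_cases i <;> fin_cases j <;> simp [X] at hij ⊢ <;> omega
    · intro i j hij n hn
      rintro _ ⟨v, hv, rfl⟩
      change (_ ^ n : _) • v ∈ X i
      rw [← map_zpow, LinearEquiv.smul_def, Matrix.SpecialLinearGroup.toLin'_apply]
      fin_cases i <;> fin_cases j <;> simp only [X] at hij hv ⊢
      · exact absurd rfl hij
      · have hv : |v 0| < |v 1| := hv
        have := key n (v 0) (v 1) hn hv
        simpa [← zpow_mul, coe_T_zpow, Matrix.toLin'_apply, Matrix.mulVec, dotProduct,
          Fin.sum_univ_two] using this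
      · have hv : |v 1| < |v 0| := hv
        have := key n (v 1) (v 0) hn hv
        have e : (S * T ^ (-m) * S⁻¹) ^ n = S * T ^ (-(m * n)) * S⁻¹ := by
          rw [conj_zpow, ← zpow_mul, neg_mul]
        simp only [Fin.mk_one, Matrix.cons_val_one, Matrix.cons_val_fin_one, e,
          coe_S_mul_T_zpow_mul_S_inv]
        simpa [Matrix.toLin'_apply, Matrix.mulVec, dotProduct, Fin.sum_univ_two,
          add_comm] using this
      · exact absurd rfl hij
  have e : FreeGroup.lift
      (fun i => Matrix.SpecialLinearGroup.toLin'
        ((![T ^ m, S * T ^ (-m) * S⁻¹] : Fin 2 → SL(2, ℤ)) i)) =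
      (Matrix.SpecialLinearGroup.toLin' (R := ℤ) (n := Fin 2)).comp (sanov m) := by
    ext i
    simp [sanov]
  rw [e, MonoidHom.coe_comp] at h
  exact h.of_comp

theorem dvd_sanov_sub_one (m : ℤ) (g : FreeGroup (Fin 2)) (i j : Fin 2) :
    m ∣ ((sanov m g : Matrix (Fin 2) (Fin 2) ℤ) - 1) i j := by
  have h : (Matrix.SpecialLinearGroup.map (Int.castRingHom (ℤ ⧸ Ideal.span {m}))).comp (sanov m)
      = 1 := by
    have hm : (m : ℤ ⧸ Ideal.span {m}) = 0 := by
      have : ((Ideal.Quotient.mk (Ideal.span {m})) m) = 0 :=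
        Ideal.Quotient.eq_zero_iff_mem.2 (Ideal.mem_span_singleton_self m)
      rwa [eq_intCast] at this
    ext k i j
    fin_cases k
    · simp only [sanov, MonoidHom.comp_apply, FreeGroup.lift_apply_of]
      simp only [Fin.zero_eta, Matrix.cons_val_zero, Matrix.SpecialLinearGroup.map_apply_coe,
        coe_T_zpow]
      fin_cases i <;> fin_cases j <;> simp [hm]
    · simp only [sanov, MonoidHom.comp_apply, FreeGroup.lift_apply_of]
      simp only [Fin.mk_one, Matrix.cons_val_one, Matrix.cons_val_fin_one,
        Matrix.SpecialLinearGroup.map_apply_coe, coe_S_mul_T_zpow_mul_S_inv]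
      fin_cases i <;> fin_cases j <;> simp [hm]
  have h' := congrArg (fun A : Matrix.SpecialLinearGroup (Fin 2) (ℤ ⧸ Ideal.span {m}) =>
    (A : Matrix (Fin 2) (Fin 2) (ℤ ⧸ Ideal.span {m})) i j) (DFunLike.congr_fun h g)
  simp only [MonoidHom.comp_apply, Matrix.SpecialLinearGroup.map_apply_coe, MonoidHom.one_apply,
    Matrix.SpecialLinearGroup.coe_one] at h'
  rw [← Ideal.mem_span_singleton, ← Ideal.Quotient.eq_zero_iff_mem, eq_intCast]
  rw [Matrix.sub_apply, Int.cast_sub, sub_eq_zero]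
  have h2 : ((1 : Matrix (Fin 2) (Fin 2) ℤ) i j : ℤ ⧸ Ideal.span {m}) =
      (1 : Matrix (Fin 2) (Fin 2) (ℤ ⧸ Ideal.span {m})) i j := by
    simp [Matrix.one_apply]
  rw [h2]
  exact h'

variable (R : Type*) [CommRing R]

/-- The extension of `sanov m` to the group ring. -/
noncomputable def sanovAlg (m : ℤ) :
    MonoidAlgebra R (FreeGroup (Fin 2)) →ₐ[R] Matrix (Fin 2) (Fin 2) R :=
  MonoidAlgebra.lift R _ (FreeGroup (Fin 2))
    (((Int.castRingHom R).mapMatrix : Matrix (Fin 2) (Fin 2) ℤ →+* _).toMonoidHom.comp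
      (Matrix.SpecialLinearGroup.coeMonoidHom.comp (sanov m)))

variable {R}

theorem sanovAlg_of (m : ℤ) (g : FreeGroup (Fin 2)) (i j : Fin 2) :
    sanovAlg R m (MonoidAlgebra.of R _ g) i j =
      ((sanov m g : Matrix (Fin 2) (Fin 2) ℤ) i j : R) := by
  simp [sanovAlg, Matrix.SpecialLinearGroup.coeMonoidHom]
  rfl

theorem sanovAlg_delta (m : ℤ) (g : FreeGroup (Fin 2)) (i j : Fin 2) :
    sanovAlg R m (delta R g) i j =
      (((sanov m g : Matrix (Fin 2) (Fin 2) ℤ) - 1) i j : ℤ) := by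
  rw [delta, map_sub, map_one, Matrix.sub_apply, sanovAlg_of, Matrix.sub_apply, Int.cast_sub]
  simp [Matrix.one_apply]

/-- Modulo m every group element acts as the identity, so u acts as its augmentation, itself
divisible by m here. -/
theorem dvd_sanovAlg_of_mem_augIdeal {m : ℤ} {r : R} (hr : (m : R) ∣ r)
    {u : MonoidAlgebra R (FreeGroup (Fin 2))} (hu : u ∈ augIdeal r) (i j : Fin 2) :
    (m : R) ∣ sanovAlg R m u i j := by
  have key : ∀ u, (m : R) ∣ (sanovAlg R m u - augmentation R u • 1) i j := by
    intro u
    induction u using MonoidAlgebra.induction_on with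
    | of g =>
      have h := sanovAlg_delta (R := R) m g i j
      rw [delta, map_sub, map_one] at h
      rw [augmentation_of, one_smul, h]
      exact map_dvd (Int.castRingHom R) (dvd_sanov_sub_one m g i j)
    | add x y hx hy =>
      have := dvd_add hx hy
      rw [← Matrix.add_apply] at this
      rwa [map_add, map_add, add_smul, add_sub_add_comm]
    | smul c x hx =>
      have := hx.mul_left c
      rw [← smul_eq_mul, ← Matrix.smul_apply] at this
      rw [map_smul, map_smul, smul_eq_mul, mul_smul, ← smul_sub]
      exact this
  have h1 := key u
  rw [Matrix.sub_apply, Matrix.smul_apply, smul_eq_mul] at h1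
  have h2 : (m : R) ∣ augmentation R u * (1 : Matrix (Fin 2) (Fin 2) R) i j :=
    (hr.trans (mem_augIdeal.1 hu)).mul_right _
  exact (dvd_sub_left h2).1 h1

theorem pow_dvd_sanovAlg_of_mem_pow {m : ℤ} {r : R} (hr : (m : R) ∣ r) (k : ℕ)
    {u : MonoidAlgebra R (FreeGroup (Fin 2))} (hu : u ∈ augIdeal r ^ k) (i j : Fin 2) :
    (m : R) ^ k ∣ sanovAlg R m u i j := by
  induction k generalizing u i j with
  | zero => simp
  | succ k ih =>
    rw [pow_succ] at hu
    induction hu using Submodule.mul_induction_on' with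
    | mem_mul_mem a ha b hb =>
      rw [map_mul, Matrix.mul_apply]
      refine Finset.dvd_sum fun l _ => ?_
      rw [pow_succ]
      exact mul_dvd_mul (ih ha i l) (dvd_sanovAlg_of_mem_augIdeal hr hb l j)
    | add a _ b _ h1 h2 => rw [map_add, Matrix.add_apply]; exact dvd_add h1 h2

/-- The entries of the matrix of g - 1 are divisible by every m^k, hence vanish, and the
representation is faithful. -/
theorem eq_one_of_delta_mem_pow [CharZero R] {m : ℤ} (hm : 2 ≤ m) {r : R} (hr : (m : R) ∣ r)
    (hsep : ∀ x : R, (∀ k : ℕ, (m : R) ^ k ∣ x) → x = 0) {g : FreeGroup (Fin 2)}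
    (hg : ∀ k : ℕ, delta R g ∈ augIdeal r ^ (k + 1)) : g = 1 := by
  apply sanov_injective hm
  rw [map_one]
  ext i j
  have h := hsep (sanovAlg R m (delta R g) i j) fun k =>
    (pow_dvd_pow _ k.le_succ).trans (pow_dvd_sanovAlg_of_mem_pow hr _ (hg k) i j)
  rw [sanovAlg_delta, Int.cast_eq_zero, Matrix.sub_apply, sub_eq_zero] at h
  exact h

end Sanov

/-! ### Case b): M unipotent modulo a prime -/

section Unipotent

variable {φ : MulAut (FreeGroup (Fin 2))} {R : Type*} [CommRing R]

/-- The endomorphism `φ - 1` of the group ring. -/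
noncomputable def autSub (R : Type*) [CommRing R] (φ : MulAut (FreeGroup (Fin 2))) :
    Module.End R (MonoidAlgebra R (FreeGroup (Fin 2))) :=
  (autAlg R φ).toAlgHom.toLinearMap - 1

@[simp] theorem autSub_apply (u : MonoidAlgebra R (FreeGroup (Fin 2))) :
    autSub R φ u = autAlg R φ u - u := rfl

theorem autSub_mem_pow {r : R} {k : ℕ} {u : MonoidAlgebra R (FreeGroup (Fin 2))}
    (hu : u ∈ augIdeal r ^ k) : autSub R φ u ∈ augIdeal r ^ k :=
  sub_mem ((autAlg_mem_pow_iff φ k).2 hu) hu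

theorem autSub_pow_mem_pow {r : R} {k : ℕ} (n : ℕ) {u : MonoidAlgebra R (FreeGroup (Fin 2))}
    (hu : u ∈ augIdeal r ^ k) : (autSub R φ ^ n) u ∈ augIdeal r ^ k := by
  induction n with
  | zero => exact hu
  | succ n ih =>
    rw [pow_succ', Module.End.mul_apply]
    exact autSub_mem_pow ih

theorem autSub_mem_augIdeal (r : R) (u : MonoidAlgebra R (FreeGroup (Fin 2))) :
    autSub R φ u ∈ augIdeal r := by
  rw [mem_augIdeal, autSub_apply, map_sub, augmentation_autAlg, sub_self]
  exact dvd_zero r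

theorem smul_mem_augIdeal_pow {r : R} {k : ℕ} {u : MonoidAlgebra R (FreeGroup (Fin 2))}
    (hu : u ∈ augIdeal r ^ k) : r • u ∈ augIdeal r ^ (k + 1) := by
  rw [Algebra.smul_def]
  refine mul_mem_augIdeal_pow_succ ?_ hu
  rw [mem_augIdeal, AlgHom.commutes]
  exact dvd_refl r

theorem delta_mul_sub_mem (r : R) (g h : FreeGroup (Fin 2)) :
    delta R (g * h) - (delta R g + delta R h) ∈ augIdeal r ^ 2 := by
  rw [delta_mul, pow_two, add_assoc, add_sub_cancel_right]
  exact Submodule.mul_mem_mul (delta_mem_augIdeal r g) (delta_mem_augIdeal r h)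

theorem delta_inv_add_mem (r : R) (g : FreeGroup (Fin 2)) :
    delta R g⁻¹ + delta R g ∈ augIdeal r ^ 2 := by
  have := neg_mem (delta_mul_sub_mem r g⁻¹ g)
  rw [inv_mul_cancel, delta_one, zero_sub, neg_neg] at this
  exact this

theorem delta_pow_mem (p : ℕ) (g : FreeGroup (Fin 2)) :
    delta R (g ^ p) ∈ augIdeal (p : R) ^ 2 := by
  have h : ∀ n : ℕ, delta R (g ^ n) - (n : R) • delta R g ∈ augIdeal (p : R) ^ 2 := by
    intro n
    induction n with
    | zero => simp [delta_one]
    | succ n ih =>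
      have := add_mem (delta_mul_sub_mem (p : R) (g ^ n) g) ih
      rw [← pow_succ] at this
      rw [Nat.cast_succ, add_smul, one_smul]
      convert this using 1
      abel
  have h2 : (p : R) • delta R g ∈ augIdeal (p : R) ^ 2 :=
    smul_mem_augIdeal_pow (k := 1) (by rw [pow_one]; exact delta_mem_augIdeal _ g)
  simpa using add_mem (h p) h2

theorem delta_mem_sq_of_exponents {p : ℕ} {g : FreeGroup (Fin 2)} {w : Fin 2 → ℤ}
    (h : exponents g = p • w) : delta R g ∈ augIdeal (p : R) ^ 2 := by
  let D := congruenceSubgroup (r := (p : R)) (k := 0) (augIdeal (p : R) ^ 2) le_rfl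
    (augIdeal_pow_succ_le _ 0)
  have hc : commutator (FreeGroup (Fin 2)) ≤ D := by
    refine Subgroup.commutator_le.2 fun a _ b _ => ?_
    rw [mem_congruenceSubgroup, delta_commutator]
    refine mul_mem_pow_of_left ?_ _
    rw [pow_succ, pow_one]
    exact sub_mem (Submodule.mul_mem_mul (delta_mem_augIdeal _ a) (delta_mem_augIdeal _ b))
      (Submodule.mul_mem_mul (delta_mem_augIdeal _ b) (delta_mem_augIdeal _ a))
  obtain ⟨z, hz⟩ := exponents_surjective w
  have h1 := hc (mul_inv_mem_commutator_of_exponents_eq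
    (show exponents g = exponents (z ^ p) by rw [h, exponents_pow, hz]))
  have h2 : z ^ p ∈ D := delta_pow_mem p z
  have := mul_mem h1 h2
  rwa [inv_mul_cancel_right] at this

/-- Modulo J², g ↦ g - 1 is additive, so (φ - 1)²g corresponds to (M - 1)²v = (τ - 2)Mv + (1 - det
M)v, a multiple of p. -/
theorem autSub_sq_mem {p : ℕ} (h1 : (p : ℤ) ∣ (autMatrix φ).trace - 2)
    (h2 : (p : ℤ) ∣ 1 - (autMatrix φ).det) (u : MonoidAlgebra R (FreeGroup (Fin 2))) :
    (autSub R φ ^ 2) u ∈ augIdeal (p : R) ^ 2 := by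
  induction u using MonoidAlgebra.induction_on with
  | add x y hx hy => rw [map_add]; exact add_mem hx hy
  | smul c x hx => rw [map_smul]; exact Submodule.smul_mem _ _ hx
  | of g =>
    obtain ⟨a, ha⟩ := h1
    obtain ⟨b, hb⟩ := h2
    let P := augIdeal (p : R) ^ 2
    have e : exponents (φ (φ g) * ((φ g)⁻¹ * ((φ g)⁻¹ * g))) =
        p • (a • (autMatrix φ).mulVec (exponents g) + b • exponents g) := by
      simp only [exponents_mul, exponents_inv, exponents_aut, Matrix.cayleyHamilton_fin_two]
      ext i
      simp only [Pi.add_apply, Pi.neg_apply, Pi.smul_apply, Pi.sub_apply, smul_eq_mul,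
        nsmul_eq_mul]
      linear_combination ((autMatrix φ).mulVec (exponents g) i) * ha + exponents g i * hb
    have h0 : delta R _ ∈ P := delta_mem_sq_of_exponents e
    have h3 := delta_mul_sub_mem (p : R) (φ (φ g)) ((φ g)⁻¹ * ((φ g)⁻¹ * g))
    have h4 := delta_mul_sub_mem (p : R) (φ g)⁻¹ ((φ g)⁻¹ * g)
    have h5 := delta_mul_sub_mem (p : R) (φ g)⁻¹ g
    have h6 := delta_inv_add_mem (p : R) (φ g)
    have h7 := add_mem (sub_mem (sub_mem (sub_mem h0 h3) h4) h5) (sub_mem (neg_mem h6) h6)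
    rw [pow_two (autSub R φ), Module.End.mul_apply]
    simp only [autSub_apply, map_sub, autAlg_of]
    convert h7 using 1
    simp only [delta]
    abel

theorem autAlg_pow (n : ℕ) (u : MonoidAlgebra R (FreeGroup (Fin 2))) :
    autAlg R (φ ^ n) u = ((autSub R φ + 1) ^ n) u := by
  induction n generalizing u with
  | zero =>
    rw [pow_zero, pow_zero, Module.End.one_apply]
    induction u using MonoidAlgebra.induction_on with
    | of g => rw [autAlg_of, MulAut.one_apply]
    | add x y hx hy => rw [map_add, hx, hy]
    | smul c x hx => rw [map_smul, hx]
  | succ n ih =>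
    rw [pow_succ (autSub R φ + 1), Module.End.mul_apply, ← ih, LinearMap.add_apply,
      Module.End.one_apply, autSub_apply, sub_add_cancel]
    clear ih
    induction u using MonoidAlgebra.induction_on with
    | of g => rw [autAlg_of, autAlg_of, autAlg_of, pow_succ, MulAut.mul_apply]
    | add x y hx hy => rw [map_add, hx, hy, map_add, map_add]
    | smul c x hx => rw [map_smul, hx, map_smul, map_smul]

/-- Binomial expansion of (1 + (φ - 1))^p: the middle coefficients are divisible by p, and `X`
collects the quotients. -/
theorem exists_autSub_pow_eq {p : ℕ} (hp : p.Prime) (φ : MulAut (FreeGroup (Fin 2))) :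
    ∃ X : Module.End R (MonoidAlgebra R (FreeGroup (Fin 2))),
      (∀ (k : ℕ) (u), u ∈ augIdeal (p : R) ^ k → X u ∈ augIdeal (p : R) ^ k) ∧
      ∀ u, autAlg R (φ ^ p) u = (autSub R φ ^ p) u + u + (p : R) • autSub R φ (X u) := by
  refine ⟨∑ i ∈ Finset.Ioo 0 p, autSub R φ ^ (i - 1) * 1 ^ (p - i - 1) * ↑(p.choose i / p), ?_, ?_⟩
  · intro k u hu
    rw [LinearMap.sum_apply]
    refine sum_mem fun i _ => ?_
    rw [one_pow, mul_one, Module.End.mul_apply, Module.End.natCast_apply, map_nsmul]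
    exact nsmul_mem (autSub_pow_mem_pow _ hu) _
  · intro u
    rw [autAlg_pow, (Commute.one_right (autSub R φ)).add_pow_prime_eq hp, one_pow, mul_one,
      mul_assoc, LinearMap.add_apply, LinearMap.add_apply, Module.End.mul_apply,
      Module.End.mul_apply, Nat.cast_smul_eq_nsmul]
    rfl

/-- Since φ^p is multiplicative and trivial modulo J², it is trivial on every J^{k+1}/J^{k+2}. -/
theorem autAlg_pow_sub_mem {p : ℕ} (hp : p.Prime) (h1 : (p : ℤ) ∣ (autMatrix φ).trace - 2)
    (h2 : (p : ℤ) ∣ 1 - (autMatrix φ).det) (k : ℕ) {u : MonoidAlgebra R (FreeGroup (Fin 2))}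
    (hu : u ∈ augIdeal (p : R) ^ (k + 1)) :
    autAlg R (φ ^ p) u - u ∈ augIdeal (p : R) ^ (k + 2) := by
  have hbase : ∀ u, autAlg R (φ ^ p) u - u ∈ augIdeal (p : R) ^ 2 := by
    intro u
    obtain ⟨X, _, hX⟩ := exists_autSub_pow_eq (R := R) hp φ
    rw [hX, add_right_comm, add_sub_cancel_right]
    refine add_mem ?_ (smul_mem_augIdeal_pow (k := 1) ?_)
    · have e : (autSub R φ ^ p) u = (autSub R φ ^ 2) ((autSub R φ ^ (p - 2)) u) := by
        rw [← Module.End.mul_apply, ← pow_add (autSub R φ), Nat.add_sub_cancel' hp.two_le]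
      rw [e]
      exact autSub_sq_mem h1 h2 _
    · rw [pow_one]
      exact autSub_mem_augIdeal _ _
  induction k generalizing u with
  | zero => exact hbase u
  | succ k ih =>
    rw [pow_succ] at hu
    induction hu using Submodule.mul_induction_on' with
    | mem_mul_mem a ha b hb =>
      have e : autAlg R (φ ^ p) (a * b) - a * b = (autAlg R (φ ^ p) a - a) * autAlg R (φ ^ p) b +
          a * (autAlg R (φ ^ p) b - b) := by
        rw [map_mul]
        noncomm_ring
      rw [e]
      refine add_mem (mul_mem_augIdeal_pow_succ' (ih ha) ?_) (mul_mem_augIdeal_pow ha (hbase b))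
      rw [mem_augIdeal, augmentation_autAlg]
      exact mem_augIdeal.1 hb
    | add a _ b _ h1 h2 =>
      rw [map_add, add_sub_add_comm]
      exact add_mem h1 h2

/-- Passing through φ^p keeps the exponent p independent of k: (φ - 1)^p differs from φ^p - 1 by p
times an operator preserving J^{k+1}, and p raises the degree. -/
theorem autSub_pow_prime_mem {p : ℕ} (hp : p.Prime) (h1 : (p : ℤ) ∣ (autMatrix φ).trace - 2)
    (h2 : (p : ℤ) ∣ 1 - (autMatrix φ).det) (k : ℕ) {u : MonoidAlgebra R (FreeGroup (Fin 2))}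
    (hu : u ∈ augIdeal (p : R) ^ (k + 1)) :
    (autSub R φ ^ p) u ∈ augIdeal (p : R) ^ (k + 2) := by
  obtain ⟨X, hXm, hX⟩ := exists_autSub_pow_eq (R := R) hp φ
  have e : (autSub R φ ^ p) u = (autAlg R (φ ^ p) u - u) - (p : R) • autSub R φ (X u) := by
    rw [hX]; abel
  rw [e]
  exact sub_mem (autAlg_pow_sub_mem hp h1 h2 k hu)
    (smul_mem_augIdeal_pow (autSub_mem_pow (hXm _ _ hu)))

theorem autAlg_comp_autSub_pow (n : ℕ) (u : MonoidAlgebra R (FreeGroup (Fin 2))) :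
    (autSub R φ ^ n) (autAlg R φ u) = autAlg R φ ((autSub R φ ^ n) u) := by
  induction n with
  | zero => rfl
  | succ n ih =>
    rw [pow_succ', Module.End.mul_apply, Module.End.mul_apply, ih, autSub_apply, autSub_apply,
      map_sub]

/-- The elements of `J ^ (k + 1)` that `(φ - 1) ^ n` sends to `J ^ (k + 2)`. -/
noncomputable def autSubFiltration (φ : MulAut (FreeGroup (Fin 2))) (r : R) (k n : ℕ) :
    Submodule R (MonoidAlgebra R (FreeGroup (Fin 2))) :=
  augIdeal r ^ (k + 1) ⊓ (augIdeal r ^ (k + 2)).comap (autSub R φ ^ n)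

/-- The filtration `W p` is all of J^{k+1}, `W 0` is J^{k+2}, and φ - 1 sends `W (j + 1)` into `W
j`; thus p commutators descend one layer. -/
theorem exists_lowerCentralSeries_le {p : ℕ} (hp : p.Prime)
    (h1 : (p : ℤ) ∣ (autMatrix φ).trace - 2) (h2 : (p : ℤ) ∣ 1 - (autMatrix φ).det) (k : ℕ) :
    ∃ n : ℕ, ∀ x ∈ (⊤ : Subgroup (FreeTwoByZ φ)).lowerCentralSeries n,
      ∃ g, delta ℤ g ∈ augIdeal (p : ℤ) ^ (k + 1) ∧ inl g = x := by
  induction k with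
  | zero =>
    refine ⟨1, fun x hx => ?_⟩
    have h : lcs (FreeTwoByZ φ) 2 = _ := lcs_nat (FreeTwoByZ φ) 1
    rw [← h] at hx
    obtain ⟨g, _, rfl⟩ := lcs_le_range_inl φ hx
    exact ⟨g, by rw [zero_add, pow_one]; exact delta_mem_augIdeal _ g, rfl⟩
  | succ k ih =>
    obtain ⟨n, hn⟩ := ih
    let W := autSubFiltration φ (p : ℤ) k
    have hW1 : ∀ i, augIdeal (p : ℤ) ^ (k + 2) ≤ W i := fun i u hu =>
      ⟨augIdeal_pow_succ_le _ _ hu, autSub_pow_mem_pow i hu⟩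
    have hW2 : ∀ i, W i ≤ augIdeal (p : ℤ) ^ (k + 1) := fun i => inf_le_left
    have key : ∀ i j, i + j = p → (⊤ : Subgroup (FreeTwoByZ φ)).lowerCentralSeries (n + i) ≤
        (congruenceSubgroup (W j) (hW1 j) (hW2 j)).map inl := by
      intro i
      induction i with
      | zero =>
        rintro j e x hx
        obtain ⟨g, hg, rfl⟩ := hn x hx
        rw [zero_add] at e
        exact ⟨g, ⟨hg, e ▸ autSub_pow_prime_mem hp h1 h2 k hg⟩, rfl⟩
      | succ i ih =>
        intro j e
        refine (Subgroup.commutator_mono (ih (j + 1) (by omega)) le_rfl).trans ?_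
        apply commutator_congruenceSubgroup_le
        · intro u
          change _ ∧ (autSub ℤ φ ^ j) (autAlg ℤ φ u) ∈ augIdeal (p : ℤ) ^ (k + 2) ↔ _ ∧ _
          rw [autAlg_comp_autSub_pow]
          exact and_congr (autAlg_mem_pow_iff φ _) (autAlg_mem_pow_iff φ _)
        · intro u hu
          refine ⟨autSub_mem_pow hu.1, ?_⟩
          have h : (autSub ℤ φ ^ (j + 1)) u ∈ augIdeal (p : ℤ) ^ (k + 2) := hu.2
          rwa [pow_succ (autSub ℤ φ), Module.End.mul_apply] at h
    refine ⟨n + p, fun x hx => ?_⟩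
    obtain ⟨g, hg, rfl⟩ := key p 0 (add_zero p) hx
    exact ⟨g, hg.2, rfl⟩

theorem lcs_omega_eq_bot {p : ℕ} (hp : p.Prime) (h1 : (p : ℤ) ∣ (autMatrix φ).trace - 2)
    (h2 : (p : ℤ) ∣ 1 - (autMatrix φ).det) : lcs (FreeTwoByZ φ) Ordinal.omega0 = ⊥ := by
  rw [eq_bot_iff]
  intro x hx
  have hmem : ∀ k : ℕ, ∃ g, delta ℤ g ∈ augIdeal (p : ℤ) ^ (k + 1) ∧ inl g = x := by
    intro k
    obtain ⟨n, hn⟩ := exists_lowerCentralSeries_le hp h1 h2 k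
    apply hn
    rw [← lcs_nat]
    exact lcs_omega_le _ _ hx
  obtain ⟨g, _, rfl⟩ := hmem 0
  have : g = 1 := by
    refine eq_one_of_delta_mem_pow (R := ℤ) (m := p) (by exact_mod_cast hp.two_le) (r := (p : ℤ))
      (by simp) ?_ fun k => ?_
    · intro y hy
      by_contra hne
      have hf : FiniteMultiplicity (p : ℤ) y := by
        rw [Int.finiteMultiplicity_iff]
        exact ⟨by simpa using hp.ne_one, hne⟩
      obtain ⟨n, hn⟩ := hf
      exact hn (by simpa using hy (n + 1))
    · obtain ⟨g', hg', e⟩ := hmem k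
      rwa [inl_injective e] at hg'
  rw [this, map_one]
  exact one_mem _

end Unipotent

/-! ### Fox calculus and Magnus coefficients -/

section Fox

variable {R : Type*} [CommRing R]

/-- The matrix `!![x_j, δ_ij; 0, 1]`, whose upper right entry computes the Fox derivative. -/
noncomputable def foxUnit (R : Type*) [CommRing R] (i j : Fin 2) :
    (Matrix (Fin 2) (Fin 2) (MonoidAlgebra R (FreeGroup (Fin 2))))ˣ where
  val := !![MonoidAlgebra.of R _ (FreeGroup.of j), if i = j then 1 else 0; 0, 1]
  inv := !![MonoidAlgebra.of R _ (FreeGroup.of j)⁻¹,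
    -MonoidAlgebra.of R _ (FreeGroup.of j)⁻¹ * (if i = j then 1 else 0); 0, 1]
  val_inv := by
    ext a b
    rw [Matrix.mul_fin_two, ← mul_assoc, mul_neg, ← map_mul, mul_inv_cancel, map_one]
    split_ifs <;> fin_cases a <;> fin_cases b <;> simp
  inv_val := by
    ext a b
    rw [Matrix.mul_fin_two, ← map_mul, inv_mul_cancel, map_one]
    split_ifs <;> fin_cases a <;> fin_cases b <;> simp

/-- The algebra homomorphism whose upper right entry is the Fox derivative. -/
noncomputable def foxHom (R : Type*) [CommRing R] (i : Fin 2) :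
    MonoidAlgebra R (FreeGroup (Fin 2)) →ₐ[R]
      Matrix (Fin 2) (Fin 2) (MonoidAlgebra R (FreeGroup (Fin 2))) :=
  MonoidAlgebra.lift R _ (FreeGroup (Fin 2))
    ((Units.coeHom _).comp (FreeGroup.lift (foxUnit R i)))

/-- The Fox derivative with respect to the `i`-th generator. -/
noncomputable def fox (R : Type*) [CommRing R] (i : Fin 2) :
    Module.End R (MonoidAlgebra R (FreeGroup (Fin 2))) where
  toFun u := foxHom R i u 0 1
  map_add' u v := by rw [map_add, Matrix.add_apply]
  map_smul' c u := by rw [map_smul, Matrix.smul_apply, RingHom.id_apply]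

theorem foxHom_of (i : Fin 2) (g : FreeGroup (Fin 2)) :
    foxHom R i (MonoidAlgebra.of R _ g) = (FreeGroup.lift (foxUnit R i) g).val := by
  simp [foxHom]

theorem fox_of_of (i j : Fin 2) : fox R i (MonoidAlgebra.of R _ (FreeGroup.of j)) =
    if i = j then 1 else 0 := by
  change foxHom R i _ 0 1 = _
  rw [foxHom_of, FreeGroup.lift_apply_of]
  simp [foxUnit]

theorem fox_of_inv (i j : Fin 2) : fox R i (MonoidAlgebra.of R _ (FreeGroup.of j)⁻¹) =
    -MonoidAlgebra.of R _ (FreeGroup.of j)⁻¹ * (if i = j then 1 else 0) := by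
  change foxHom R i _ 0 1 = _
  rw [foxHom_of, map_inv, FreeGroup.lift_apply_of]
  change (!![_, _; _, _] : Matrix (Fin 2) (Fin 2) (MonoidAlgebra R (FreeGroup (Fin 2)))) 0 1 = _
  simp

/-- The image of u is upper triangular with diagonal (u, ε(u)); multiplying such matrices gives the
Fox product rule. -/
theorem foxHom_entries (i : Fin 2) (u : MonoidAlgebra R (FreeGroup (Fin 2))) :
    foxHom R i u 0 0 = u ∧ foxHom R i u 1 0 = 0 ∧
      foxHom R i u 1 1 = algebraMap R _ (augmentation R u) := by
  induction u using MonoidAlgebra.induction_on with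
  | of g =>
    induction g using FreeGroup.induction_on with
    | C1 =>
      rw [map_one (MonoidAlgebra.of R _), map_one, map_one (augmentation R), map_one]
      simp
    | of j =>
      rw [augmentation_of, foxHom_of, FreeGroup.lift_apply_of]
      simp [foxUnit, MonoidAlgebra.one_def]
    | inv_of j _ =>
      rw [augmentation_of, foxHom_of, map_inv, FreeGroup.lift_apply_of, map_one]
      exact ⟨rfl, rfl, rfl⟩
    | mul g h hg hh =>
      obtain ⟨g1, g2, g3⟩ := hg
      obtain ⟨h1, h2, h3⟩ := hh
      rw [map_mul (MonoidAlgebra.of R _), map_mul, map_mul]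
      simp only [Matrix.mul_apply, Fin.sum_univ_two, g1, g2, g3, h1, h2, h3, map_mul]
      simp
  | add x y hx hy =>
    obtain ⟨g1, g2, g3⟩ := hx
    obtain ⟨h1, h2, h3⟩ := hy
    simp only [map_add, Matrix.add_apply, g1, g2, g3, h1, h2, h3, add_zero, and_self]
  | smul c x hx =>
    obtain ⟨g1, g2, g3⟩ := hx
    simp only [map_smul, Matrix.smul_apply, g1, g2, g3, smul_zero, true_and]
    rw [smul_eq_mul, map_mul, Algebra.smul_def]

theorem fox_mul (i : Fin 2) (u v : MonoidAlgebra R (FreeGroup (Fin 2))) :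
    fox R i (u * v) = u * fox R i v + augmentation R v • fox R i u := by
  change foxHom R i (u * v) 0 1 = u * foxHom R i v 0 1 + _ • foxHom R i u 0 1
  rw [map_mul, Matrix.mul_apply, Fin.sum_univ_two, (foxHom_entries i u).1,
    (foxHom_entries i v).2.2, Algebra.smul_def, Algebra.commutes]

theorem fox_one (i : Fin 2) : fox R i 1 = 0 := by
  change foxHom R i 1 0 1 = 0
  rw [map_one]
  simp

/-- The fundamental formula of the Fox calculus. -/
theorem sum_fox_mul_delta (u : MonoidAlgebra R (FreeGroup (Fin 2))) :
    ∑ i, fox R i u * delta R (FreeGroup.of i) = u - algebraMap R _ (augmentation R u) := by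
  induction u using MonoidAlgebra.induction_on with
  | of g =>
    induction g using FreeGroup.induction_on with
    | C1 => rw [map_one, map_one, map_one, sub_self]; simp [fox_one]
    | of j => 
      rw [augmentation_of, map_one]
      simp only [fox_of_of, ite_mul, one_mul, zero_mul, Finset.sum_ite_eq', Finset.mem_univ,
        if_true, delta]
    | inv_of j _ =>
      simp only [fox_of_inv, mul_ite, mul_one, mul_zero, ite_mul, zero_mul, Finset.sum_ite_eq',
        Finset.mem_univ, if_true, delta, augmentation_of, map_one]
      rw [mul_sub, neg_mul, ← map_mul, inv_mul_cancel, map_one, mul_one, sub_neg_eq_add]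
      abel
    | mul g h hg hh =>
      rw [map_mul (MonoidAlgebra.of R _)]
      simp only [fox_mul, add_mul, Finset.sum_add_distrib, mul_assoc,
        ← Finset.mul_sum, hg, hh, augmentation_of, map_one, map_mul, one_smul,
        mul_one]
      noncomm_ring
  | add x y hx hy =>
    simp only [map_add, add_mul, Finset.sum_add_distrib, hx, hy]
    abel
  | smul c x hx =>
    simp only [map_smul, smul_mul_assoc, ← Finset.smul_sum, hx, smul_sub, smul_eq_mul, map_mul,
      Algebra.smul_def c (algebraMap R _ _)]

theorem augmentation_fox_of (i : Fin 2) (g : FreeGroup (Fin 2)) :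
    augmentation R (fox R i (MonoidAlgebra.of R _ g)) = (exponents g i : R) := by
  induction g using FreeGroup.induction_on with
  | C1 => rw [map_one, fox_one]; simp
  | of j =>
    rw [fox_of_of, exponents_of, Pi.single_apply]
    split_ifs <;> simp
  | inv_of j _ =>
    rw [fox_of_inv, map_mul, map_neg, augmentation_of, exponents_inv, exponents_of, Pi.neg_apply,
      Pi.single_apply]
    split_ifs <;> simp
  | mul g h hg hh =>
    rw [map_mul, fox_mul, augmentation_of, one_smul, map_add, map_mul, augmentation_of, one_mul,
      hg, hh, exponents_mul, Pi.add_apply, Int.cast_add, add_comm]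

/-- The derivation of the group ring attached to a linear form on the abelianization. -/
noncomputable def foxForm (c : Fin 2 → R) : Module.End R (MonoidAlgebra R (FreeGroup (Fin 2))) :=
  ∑ i, c i • fox R i

theorem foxForm_apply (c : Fin 2 → R) (u : MonoidAlgebra R (FreeGroup (Fin 2))) :
    foxForm c u = ∑ i, c i • fox R i u := by
  simp [foxForm]

/-- For v in the augmentation ideal the term ε(v)∂u disappears, so derivatives strip factors from
the right. -/
theorem foxForm_mul (c : Fin 2 → R) (u : MonoidAlgebra R (FreeGroup (Fin 2)))
    {v : MonoidAlgebra R (FreeGroup (Fin 2))} (hv : v ∈ augIdeal (0 : R)) :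
    foxForm c (u * v) = u * foxForm c v := by
  rw [mem_augIdeal, zero_dvd_iff] at hv
  simp only [foxForm_apply, fox_mul, hv, zero_smul, add_zero, Finset.mul_sum, mul_smul_comm]

/-- The coefficient of a word (in the letters `c s`) in the Magnus expansion. -/
noncomputable def magnusCoeff (c : Bool → Fin 2 → R) :
    List Bool → (MonoidAlgebra R (FreeGroup (Fin 2)) →ₗ[R] R)
  | [] => (augmentation R).toLinearMap
  | s :: w => (magnusCoeff c w).comp (foxForm (c s))

theorem magnusCoeff_nil (c : Bool → Fin 2 → R) (u : MonoidAlgebra R (FreeGroup (Fin 2))) :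
    magnusCoeff c [] u = augmentation R u := rfl

theorem magnusCoeff_cons (c : Bool → Fin 2 → R) (s : Bool) (w : List Bool)
    (u : MonoidAlgebra R (FreeGroup (Fin 2))) :
    magnusCoeff c (s :: w) u = magnusCoeff c w (foxForm (c s) u) := rfl

theorem augIdeal_pow_le (r : R) {m n : ℕ} (h : m ≤ n) :
    augIdeal r ^ (n + 1) ≤ augIdeal r ^ (m + 1) := by
  induction n, h using Nat.le_induction with
  | base => exact le_rfl
  | succ n _ ih => exact (augIdeal_pow_succ_le r n).trans ih

theorem magnusCoeff_eq_zero (c : Bool → Fin 2 → R) (w : List Bool)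
    {u : MonoidAlgebra R (FreeGroup (Fin 2))} (hu : u ∈ augIdeal (0 : R) ^ (w.length + 1)) :
    magnusCoeff c w u = 0 := by
  induction w generalizing u with
  | nil =>
    rw [List.length_nil, zero_add, pow_one, mem_augIdeal, zero_dvd_iff] at hu
    exact hu
  | cons s w ih =>
    rw [List.length_cons, pow_succ] at hu
    induction hu using Submodule.mul_induction_on' with
    | mem_mul_mem a ha b hb =>
      rw [magnusCoeff_cons, foxForm_mul _ _ hb]
      exact ih (mul_mem_pow_of_left ha _)
    | add a _ b _ h1 h2 => rw [map_add, h1, h2, add_zero]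

theorem sub_augmentation_mem (u : MonoidAlgebra R (FreeGroup (Fin 2))) :
    u - algebraMap R _ (augmentation R u) ∈ augIdeal (0 : R) := by
  rw [mem_augIdeal, map_sub, AlgHom.commutes, zero_dvd_iff]
  exact sub_self _

theorem magnusCoeff_mul (c : Bool → Fin 2 → R) (w : List Bool)
    {v : MonoidAlgebra R (FreeGroup (Fin 2))} (hv : v ∈ augIdeal (0 : R) ^ w.length)
    (z : MonoidAlgebra R (FreeGroup (Fin 2))) :
    magnusCoeff c w (v * z) = augmentation R z * magnusCoeff c w v := by
  have h := magnusCoeff_eq_zero c w (mul_mem_augIdeal_pow_succ' hv (sub_augmentation_mem z))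
  rw [mul_sub, map_sub, sub_eq_zero, ← Algebra.commutes, ← Algebra.smul_def, map_smul] at h
  exact h

/-! ### Case c), upper bound: φ is diagonal on leading coefficients -/

section Eigenforms

variable {φ : MulAut (FreeGroup (Fin 2))} {c : Bool → Fin 2 → R} {ν : Bool → R}

theorem augmentation_foxForm_autAlg {c : Fin 2 → R} {ν : R}
    (hc : ∀ j, ∑ i, c i * (autMatrix φ i j : R) = ν * c j)
    (u : MonoidAlgebra R (FreeGroup (Fin 2))) :
    augmentation R (foxForm c (autAlg R φ u)) = ν * augmentation R (foxForm c u) := by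
  induction u using MonoidAlgebra.induction_on with
  | of g =>
    simp only [autAlg_of, foxForm_apply, map_sum, map_smul, augmentation_fox_of, smul_eq_mul]
    rw [exponents_aut, Fin.sum_univ_two, Fin.sum_univ_two]
    have h0 := hc 0
    have h1 := hc 1
    rw [Fin.sum_univ_two] at h0 h1
    simp only [Matrix.mulVec, dotProduct, Fin.sum_univ_two, Int.cast_add, Int.cast_mul]
    linear_combination (exponents g 0 : R) * h0 + (exponents g 1 : R) * h1
  | add x y hx hy => simp only [map_add, hx, hy, mul_add]
  | smul a x hx => simp only [map_smul, hx, smul_eq_mul, mul_left_comm]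

/-- A leading coefficient of ab, with b in the augmentation ideal, is a leading coefficient of a
times a linear form at b; each letter is an eigenform and contributes its eigenvalue. -/
theorem magnusCoeff_autAlg (hc : ∀ s j, ∑ i, c s i * (autMatrix φ i j : R) = ν s * c s j)
    (w : List Bool) {u : MonoidAlgebra R (FreeGroup (Fin 2))}
    (hu : u ∈ augIdeal (0 : R) ^ w.length) :
    magnusCoeff c w (autAlg R φ u) = (w.map ν).prod * magnusCoeff c w u := by
  induction w generalizing u with
  | nil =>
    rw [magnusCoeff_nil, magnusCoeff_nil, augmentation_autAlg, List.map_nil, List.prod_nil, one_mul]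
  | cons s w ih =>
    rw [List.length_cons, pow_succ] at hu
    induction hu using Submodule.mul_induction_on' with
    | mem_mul_mem a ha b hb =>
      have hb' : autAlg R φ b ∈ augIdeal (0 : R) := by
        rw [mem_augIdeal, augmentation_autAlg]
        exact mem_augIdeal.1 hb
      rw [map_mul, magnusCoeff_cons, magnusCoeff_cons, foxForm_mul _ _ hb, foxForm_mul _ _ hb',
        magnusCoeff_mul c w ha, magnusCoeff_mul c w ((autAlg_mem_pow_iff φ _).2 ha), ih ha,
        augmentation_foxForm_autAlg (hc s), List.map_cons, List.prod_cons]
      ring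
    | add a _ b _ h1 h2 => simp only [map_add, h1, h2, mul_add]

/-- The two forms are independent over a domain, so by Cramer both Fox derivatives have vanishing
coefficients; the fundamental formula then rebuilds u. -/
theorem mem_augIdeal_pow_of_magnusCoeff [IsDomain R]
    (hdet : c false 0 * c true 1 - c false 1 * c true 0 ≠ 0) (k : ℕ)
    {u : MonoidAlgebra R (FreeGroup (Fin 2))}
    (h : ∀ w : List Bool, w.length ≤ k → magnusCoeff c w u = 0) :
    u ∈ augIdeal (0 : R) ^ (k + 1) := by
  induction k generalizing u with
  | zero =>
    rw [zero_add, pow_one, mem_augIdeal, zero_dvd_iff]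
    exact h [] le_rfl
  | succ k ih =>
    have h0 : augmentation R u = 0 := h [] (Nat.zero_le _)
    have hi : ∀ i, fox R i u ∈ augIdeal (0 : R) ^ (k + 1) := by
      intro i
      refine ih fun w hw => ?_
      have ht := h (true :: w) (by simpa using hw)
      have hf := h (false :: w) (by simpa using hw)
      rw [magnusCoeff_cons, foxForm_apply, Fin.sum_univ_two, map_add, map_smul, map_smul,
        smul_eq_mul, smul_eq_mul] at ht hf
      refine (mul_eq_zero.1 ?_).resolve_left hdet
      fin_cases i
      · change _ * magnusCoeff c w (fox R 0 u) = 0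
        linear_combination c true 1 * hf - c false 1 * ht
      · change _ * magnusCoeff c w (fox R 1 u) = 0
        linear_combination c false 0 * ht - c true 0 * hf
    have hu := sum_fox_mul_delta u
    rw [h0, map_zero, sub_zero] at hu
    rw [← hu]
    exact sum_mem fun i _ => mul_mem_augIdeal_pow_succ' (hi i) (delta_mem_augIdeal _ _)

/-- Elements of `I ^ (k + 1)` whose leading coefficients in an eigenbasis are divisible by powers
of `ν_w - 1`. -/
noncomputable def magnusFiltration (c : Bool → Fin 2 → R) (ν : Bool → R) (k j : ℕ) :
    Submodule R (MonoidAlgebra R (FreeGroup (Fin 2))) :=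
  augIdeal (0 : R) ^ (k + 1) ⊓ ⨅ w : {w : List Bool // w.length = k + 1},
    Submodule.comap (magnusCoeff c w.1) (Ideal.span {((w.1.map ν).prod - 1) ^ j})

theorem mem_magnusFiltration {k j : ℕ} {u : MonoidAlgebra R (FreeGroup (Fin 2))} :
    u ∈ magnusFiltration c ν k j ↔ u ∈ augIdeal (0 : R) ^ (k + 1) ∧
      ∀ w : List Bool, w.length = k + 1 → ((w.map ν).prod - 1) ^ j ∣ magnusCoeff c w u := by
  simp only [magnusFiltration, Submodule.mem_inf, Submodule.mem_iInf, Subtype.forall,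
    Submodule.mem_comap]
  simp only [Ideal.mem_span_singleton]

/-- On layer k, φ - 1 multiplies the coefficient of w by ν_w - 1. After j commutators it is
divisible by (ν_w - 1)^j, so after ω of them `hsep` makes it zero and the degree rises by one. -/
theorem lcs_omega_mul_le [IsDomain R]
    (hc : ∀ s j, ∑ i, c s i * (autMatrix φ i j : R) = ν s * c s j)
    (hdet : c false 0 * c true 1 - c false 1 * c true 0 ≠ 0) (hν : ∀ s, IsUnit (ν s))
    (hsep : ∀ w : List Bool, ∀ x : R, (∀ j : ℕ, ((w.map ν).prod - 1) ^ j ∣ x) → x = 0) (k : ℕ) :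
    ∀ x ∈ lcs (FreeTwoByZ φ) (Ordinal.omega0 * (k + 1 : ℕ)),
      ∃ g, delta R g ∈ augIdeal (0 : R) ^ (k + 1) ∧ inl g = x := by
  induction k with
  | zero =>
    intro x hx
    rw [zero_add, Nat.cast_one, mul_one] at hx
    obtain ⟨g, _, rfl⟩ := lcs_le_range_inl φ (lcs_omega_le _ 2 hx)
    exact ⟨g, by rw [zero_add, pow_one]; exact delta_mem_augIdeal _ g, rfl⟩
  | succ k ih =>
    let W := magnusFiltration c ν k
    have hunit : ∀ w : List Bool, IsUnit (w.map ν).prod := fun w => by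
      induction w with
      | nil => simp
      | cons s w ih => rw [List.map_cons, List.prod_cons]; exact (hν s).mul ih
    have hW1 : ∀ i, augIdeal (0 : R) ^ (k + 2) ≤ W i := fun i u hu =>
      mem_magnusFiltration.2 ⟨augIdeal_pow_succ_le _ _ hu, fun w hw => by
        rw [magnusCoeff_eq_zero c w (by rwa [hw])]
        exact dvd_zero _⟩
    have hW2 : ∀ i, W i ≤ augIdeal (0 : R) ^ (k + 1) := fun i => inf_le_left
    have h1 : (1 : Ordinal) ≤ Ordinal.omega0 * (k + 1 : ℕ) :=
      Ordinal.one_lt_omega0.le.trans (Ordinal.le_mul_left _ (by simp))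
    have key : ∀ j : ℕ, lcs (FreeTwoByZ φ) (Ordinal.omega0 * (k + 1 : ℕ) + j) ≤
        (congruenceSubgroup (W j) (hW1 j) (hW2 j)).map inl := by
      intro j
      induction j with
      | zero =>
        rw [Nat.cast_zero, add_zero]
        intro x hx
        obtain ⟨g, hg, rfl⟩ := ih x hx
        refine ⟨g, mem_magnusFiltration.2 ⟨hg, fun w _ => ?_⟩, rfl⟩
        rw [pow_zero]
        exact one_dvd _
      | succ j ihj =>
        rw [Nat.cast_succ j, ← add_assoc, lcs_add_one _ (h1.trans (by simp))]
        refine (Subgroup.commutator_mono ihj le_rfl).trans ?_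
        apply commutator_congruenceSubgroup_le
        · intro u
          rw [mem_magnusFiltration, mem_magnusFiltration, autAlg_mem_pow_iff]
          refine and_congr_right fun hu => forall₂_congr fun w hw => ?_
          rw [magnusCoeff_autAlg hc w (by rwa [hw]), (hunit w).dvd_mul_left]
        · intro u hu
          rw [mem_magnusFiltration] at *
          refine ⟨sub_mem ((autAlg_mem_pow_iff φ _).2 hu.1) hu.1, fun w hw => ?_⟩
          rw [map_sub, magnusCoeff_autAlg hc w (by rw [hw]; exact hu.1), ← sub_one_mul, pow_succ']
          exact mul_dvd_mul_left _ (hu.2 w hw)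
    intro x hx
    rw [Nat.cast_succ (k + 1), mul_add, mul_one] at hx
    have hj : ∀ j, ∃ g, delta R g ∈ W j ∧ inl g = x := fun j => key j (lcs_add_omega_le _ _ j hx)
    obtain ⟨g, hg, rfl⟩ := hj 0
    refine ⟨g, mem_augIdeal_pow_of_magnusCoeff hdet (k + 1) fun w hw => ?_, rfl⟩
    rcases hw.lt_or_eq with hw | hw
    · exact magnusCoeff_eq_zero c w (augIdeal_pow_le _ (Nat.lt_succ_iff.1 hw) (hW2 0 hg))
    · refine hsep w _ fun j => ?_
      obtain ⟨g', hg', e⟩ := hj j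
      rw [inl_injective e] at hg'
      exact (mem_magnusFiltration.1 hg').2 w hw

end Eigenforms

end Fox

/-! ### The order ℤ[λ], λ² = τλ + 1, and its norm -/

section QuadraticOrder

variable {τ : ℤ}

theorem QuadraticAlgebra.norm_one_eq (z : QuadraticAlgebra ℤ 1 τ) :
    z.norm = z.re ^ 2 + τ * z.re * z.im - z.im ^ 2 := by
  rw [QuadraticAlgebra.norm_def]
  ring

/-- A nonzero element of norm 0 would make τ² + 4 a square t², but |t| > |τ| ≥ 3 gives t² ≥ τ² + 7.
-/
theorem QuadraticAlgebra.eq_zero_of_norm_eq_zero (hτ : 3 ≤ |τ|) {z : QuadraticAlgebra ℤ 1 τ}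
    (h : z.norm = 0) : z = 0 := by
  rw [norm_one_eq] at h
  have h4 : (2 * z.re + τ * z.im) ^ 2 = (τ ^ 2 + 4) * z.im ^ 2 := by linear_combination 4 * h
  have him : z.im = 0 := by
    by_contra hne
    have hd : z.im ∣ 2 * z.re + τ * z.im := by
      rw [← Int.pow_dvd_pow_iff two_ne_zero, h4]
      exact Dvd.intro_left _ rfl
    obtain ⟨t, ht⟩ := hd
    rw [ht] at h4
    have h5 : t ^ 2 = τ ^ 2 + 4 := by
      have : z.im ^ 2 * (t ^ 2 - (τ ^ 2 + 4)) = 0 := by linear_combination h4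
      rcases mul_eq_zero.1 this with h | h
      · exact absurd (pow_eq_zero_iff two_ne_zero |>.1 h) hne
      · linarith
    rw [← sq_abs t, ← sq_abs τ] at h5
    have h6 : |τ| < |t| := by
      by_contra hle
      have := abs_nonneg t
      nlinarith
    nlinarith
  rw [him] at h
  have hre : z.re = 0 := by
    have : z.re ^ 2 = 0 := by linear_combination h
    exact pow_eq_zero_iff two_ne_zero |>.1 this
  ext
  exacts [hre, him]

theorem QuadraticAlgebra.isDomain_of_three_le_abs (hτ : 3 ≤ |τ|) :
    IsDomain (QuadraticAlgebra ℤ 1 τ) := by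
  have : NoZeroDivisors (QuadraticAlgebra ℤ 1 τ) := ⟨fun {a b} h => by
    have h' := congrArg QuadraticAlgebra.norm h
    rw [map_mul, QuadraticAlgebra.norm_zero] at h'
    exact (mul_eq_zero.1 h').imp (eq_zero_of_norm_eq_zero hτ) (eq_zero_of_norm_eq_zero hτ)⟩
  exact NoZeroDivisors.to_isDomain _

theorem QuadraticAlgebra.eq_zero_of_forall_pow_dvd (hτ : 3 ≤ |τ|) {y x : QuadraticAlgebra ℤ 1 τ}
    (hy : y.norm.natAbs ≠ 1) (h : ∀ j : ℕ, y ^ j ∣ x) : x = 0 := by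
  apply eq_zero_of_norm_eq_zero hτ
  by_contra hne
  obtain ⟨n, hn⟩ := Int.finiteMultiplicity_iff.2 ⟨hy, hne⟩
  apply hn
  rw [← map_pow]
  exact map_dvd _ (h (n + 1))

theorem exists_real_roots (hτ : 3 ≤ |τ|) :
    ∃ α β : ℝ, α + β = τ ∧ α * β = -1 ∧ 3 ≤ |α| := by
  have hD : Real.sqrt ((τ : ℝ) ^ 2 + 4) ^ 2 = (τ : ℝ) ^ 2 + 4 := Real.sq_sqrt (by positivity)
  have hD0 := Real.sqrt_nonneg ((τ : ℝ) ^ 2 + 4)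
  set D := Real.sqrt ((τ : ℝ) ^ 2 + 4)
  have hD3 : 3 ≤ D := by
    have : (3 : ℝ) ≤ |(τ : ℝ)| := by exact_mod_cast hτ
    rw [← sq_abs (τ : ℝ)] at hD
    nlinarith
  rcases le_abs.1 hτ with h | h
  · have h' : (3 : ℝ) ≤ τ := by exact_mod_cast h
    exact ⟨(τ + D) / 2, (τ - D) / 2, by ring, by linear_combination (-1 / 4) * hD,
      le_abs.2 (Or.inl (by linarith))⟩
  · have h' : (3 : ℝ) ≤ -τ := by exact_mod_cast h
    exact ⟨(τ - D) / 2, (τ + D) / 2, by ring, by linear_combination (-1 / 4) * hD,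
      le_abs.2 (Or.inr (by linarith))⟩

/-- The product is at least (|P| - 1)(1 - |Q|) = |P| + |Q| - 2 > 1. -/
theorem one_lt_abs_sub_one_mul_sub_one {P Q : ℝ} (hP : 3 ≤ |P|) (h : |P| * |Q| = 1) :
    1 < |(P - 1) * (Q - 1)| := by
  have h1 : |P| - 1 ≤ |P - 1| := by simpa using abs_sub_abs_le_abs_sub P 1
  have h2 : 1 - |Q| ≤ |Q - 1| := by
    rw [abs_sub_comm]
    simpa using abs_sub_abs_le_abs_sub 1 Q
  have h3 : 0 < |Q| := by
    rcases (abs_nonneg Q).eq_or_lt with h0 | h0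
    · rw [← h0] at h; norm_num at h
    · exact h0
  have h4 : |Q| ≤ 1 := by nlinarith
  rw [abs_mul]
  calc 1 < (|P| - 1) * (1 - |Q|) := by nlinarith
    _ ≤ |P - 1| * |Q - 1| := mul_le_mul h1 h2 (by linarith) (abs_nonneg _)

/-- This number is the absolute norm of ν_w - 1. For i ≠ j one conjugate has size at least 3; for i
= j both are ±1 and the value is 0 or 4. -/
theorem abs_prod_pow_sub_one_ne_one {α β : ℝ} (hαβ : α * β = -1) (hα : 3 ≤ |α|) (i j : ℕ) :
    |(α ^ i * β ^ j - 1) * (β ^ i * α ^ j - 1)| ≠ 1 := by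
  have hPQ : ∀ i j : ℕ, |α ^ i * β ^ j| * |β ^ i * α ^ j| = 1 := by
    intro i j
    rw [← abs_mul, show α ^ i * β ^ j * (β ^ i * α ^ j) = (α * β) ^ i * (α * β) ^ j by ring, hαβ,
      abs_mul, abs_pow, abs_pow]
    simp
  have hbig : ∀ i m : ℕ, 3 ≤ |α ^ (i + m + 1) * β ^ i| := by
    intro i m
    rw [show α ^ (i + m + 1) * β ^ i = (α * β) ^ i * α ^ (m + 1) by ring, hαβ, abs_mul, abs_pow,
      abs_pow, abs_neg, abs_one, one_pow, one_mul]
    exact hα.trans (le_self_pow₀ (by linarith) (by simp))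
  rcases lt_trichotomy i j with h | rfl | h
  · obtain ⟨m, rfl⟩ := Nat.exists_eq_add_of_lt h
    rw [mul_comm (α ^ i * β ^ (i + m + 1) - 1), mul_comm (β ^ i), mul_comm (α ^ i)]
    refine (one_lt_abs_sub_one_mul_sub_one (hbig i m) ?_).ne'
    rw [mul_comm (β ^ _)]
    rw [mul_comm, mul_comm (α ^ (i + m + 1))]
    exact hPQ i _
  · rw [mul_comm (β ^ i), ← mul_pow, hαβ]
    rcases neg_one_pow_eq_or ℝ i with h | h <;> rw [h] <;> norm_num
  · obtain ⟨m, rfl⟩ := Nat.exists_eq_add_of_lt h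
    exact (one_lt_abs_sub_one_mul_sub_one (hbig j m) (hPQ _ _)).ne'

/-- The two conjugate roots of `X ^ 2 - τ X - 1`. -/
def conjugateRoots (τ : ℤ) (s : Bool) : QuadraticAlgebra ℤ 1 τ := if s then ⟨0, 1⟩ else ⟨τ, -1⟩

theorem natAbs_norm_prod_sub_one_ne_one (hτ : 3 ≤ |τ|) (w : List Bool) :
    ((w.map (conjugateRoots τ)).prod - 1).norm.natAbs ≠ 1 := by
  obtain ⟨α, β, h1, h2, h3⟩ := exists_real_roots hτ
  have hα : α * α = (1 : ℤ) • 1 + τ • α := by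
    simp only [zsmul_eq_mul, Int.cast_one, one_mul, ← h1]
    linear_combination -h2
  have hβ : β * β = (1 : ℤ) • 1 + τ • β := by
    simp only [zsmul_eq_mul, Int.cast_one, one_mul, ← h1]
    linear_combination -h2
  let f : QuadraticAlgebra ℤ 1 τ →ₐ[ℤ] ℝ := QuadraticAlgebra.lift ⟨α, hα⟩
  let g : QuadraticAlgebra ℤ 1 τ →ₐ[ℤ] ℝ := QuadraticAlgebra.lift ⟨β, hβ⟩
  have hf : ∀ z, f z = z.re + z.im * α := fun z => by simp [f]
  have hg : ∀ z, g z = z.re + z.im * β := fun z => by simp [g]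
  have hN : ∀ z : QuadraticAlgebra ℤ 1 τ, (z.norm : ℝ) = f z * g z := fun z => by
    rw [hf, hg, QuadraticAlgebra.norm_one_eq]
    push_cast
    linear_combination (-(z.im : ℝ) * z.re) * h1 - (z.im : ℝ) ^ 2 * h2
  have hw : ∃ i j : ℕ, f (w.map (conjugateRoots τ)).prod = α ^ i * β ^ j ∧
      g (w.map (conjugateRoots τ)).prod = β ^ i * α ^ j := by
    induction w with
    | nil => exact ⟨0, 0, by simp⟩
    | cons s w ih =>
      obtain ⟨i, j, e1, e2⟩ := ih
      rw [List.map_cons, List.prod_cons, map_mul, map_mul, e1, e2, hf, hg]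
      cases s
      · refine ⟨i, j + 1, ?_, ?_⟩
        · simp only [conjugateRoots]; simp; linear_combination (-(α ^ i * β ^ j)) * h1
        · simp only [conjugateRoots]; simp; linear_combination (-(β ^ i * α ^ j)) * h1
      · refine ⟨i + 1, j, ?_, ?_⟩
        · simp only [conjugateRoots]; simp; ring
        · simp only [conjugateRoots]; simp; ring
  obtain ⟨i, j, e1, e2⟩ := hw
  intro h
  apply abs_prod_pow_sub_one_ne_one h2 h3 i j
  rw [← e1, ← e2, ← map_one f, ← map_sub, map_one f, ← map_one g, ← map_sub, ← hN]
  rw [← Int.cast_abs, Int.abs_eq_natAbs, h]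
  simp

end QuadraticOrder

/-! ### Assembly of the three cases -/

section

variable {φ : MulAut (FreeGroup (Fin 2))}

theorem lcs_omega_sq_eq_bot (hdet : (autMatrix φ).det = -1) (hτ : 3 ≤ |(autMatrix φ).trace|) :
    lcs (FreeTwoByZ φ) (Ordinal.omega0 ^ 2) = ⊥ := by
  set τ := (autMatrix φ).trace with hτdef
  have htr := Matrix.trace_fin_two (autMatrix φ)
  rw [← hτdef] at htr
  rw [Matrix.det_fin_two] at hdet
  have hd := QuadraticAlgebra.isDomain_of_three_le_abs hτ
  have hchar : CharZero (QuadraticAlgebra ℤ 1 τ) := ⟨fun a b h => by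
    have := congrArg QuadraticAlgebra.re h
    simpa using this⟩
  -- The row (M₁₀, λ - M₀₀) is a left eigenvector of M for the root λ.
  let c : Bool → Fin 2 → QuadraticAlgebra ℤ 1 τ := fun s =>
    ![(autMatrix φ 1 0 : QuadraticAlgebra ℤ 1 τ), conjugateRoots τ s - (autMatrix φ 0 0 : ℤ)]
  have hroot : ∀ s, conjugateRoots τ s * conjugateRoots τ s = τ * conjugateRoots τ s + 1 := by
    intro s
    cases s <;> ext <;> simp [conjugateRoots] <;> rfl
  have hsum : (τ : QuadraticAlgebra ℤ 1 τ) =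
      (autMatrix φ 0 0 : ℤ) + (autMatrix φ 1 1 : ℤ) := by
    rw [← Int.cast_add]; exact congrArg _ htr
  have hdet' : ((autMatrix φ 0 0 : ℤ) : QuadraticAlgebra ℤ 1 τ) * (autMatrix φ 1 1 : ℤ) -
      (autMatrix φ 0 1 : ℤ) * (autMatrix φ 1 0 : ℤ) = -1 := by exact_mod_cast hdet
  have hc : ∀ s j, ∑ i, c s i * (autMatrix φ i j : QuadraticAlgebra ℤ 1 τ) =
      conjugateRoots τ s * c s j := by
    intro s j
    rw [Fin.sum_univ_two]
    fin_cases j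
    · simp only [c, Fin.zero_eta, Matrix.cons_val_zero, Matrix.cons_val_one,
        Matrix.cons_val_fin_one]
      ring
    · simp only [c, Fin.mk_one, Matrix.cons_val_zero, Matrix.cons_val_one,
        Matrix.cons_val_fin_one]
      linear_combination (-1 : QuadraticAlgebra ℤ 1 τ) * hroot s - hdet' -
        conjugateRoots τ s * hsum
  -- Otherwise M is triangular with diagonal entries 1 and -1, so τ = 0.
  have hM : autMatrix φ 1 0 ≠ 0 := by
    intro h0
    rw [h0, mul_zero, sub_zero] at hdet
    have : (autMatrix φ 0 0) ∣ 1 := ⟨-autMatrix φ 1 1, by linarith⟩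
    rcases Int.isUnit_iff.1 (isUnit_of_dvd_one this) with h | h <;> rw [h] at hdet htr
    · rw [show τ = 0 by omega] at hτ; norm_num at hτ
    · rw [show τ = 0 by omega] at hτ; norm_num at hτ
  -- The determinant is M₁₀ times the difference of the roots, whose λ-coordinate is 2.
  have hnd : c false 0 * c true 1 - c false 1 * c true 0 ≠ 0 := by
    intro h
    have h' := congrArg QuadraticAlgebra.im h
    simp [c, conjugateRoots] at h'
    omega
  have hν : ∀ s, IsUnit (conjugateRoots τ s) := by
    intro s
    refine IsUnit.of_mul_eq_one (conjugateRoots τ s - τ) ?_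
    linear_combination hroot s
  have hsep : ∀ w : List Bool, ∀ x : QuadraticAlgebra ℤ 1 τ,
      (∀ j : ℕ, ((w.map (conjugateRoots τ)).prod - 1) ^ j ∣ x) → x = 0 := fun w x =>
    QuadraticAlgebra.eq_zero_of_forall_pow_dvd hτ (natAbs_norm_prod_sub_one_ne_one hτ w)
  have hmem : ∀ x ∈ lcs (FreeTwoByZ φ) (Ordinal.omega0 ^ 2), ∀ k : ℕ,
      ∃ g, delta (QuadraticAlgebra ℤ 1 τ) g ∈ augIdeal 0 ^ (k + 1) ∧ inl g = x := fun x hx k =>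
    lcs_omega_mul_le hc hnd hν hsep k x (lcs_omega_sq_le _ _ hx)
  rw [eq_bot_iff]
  intro x hx
  obtain ⟨g, _, rfl⟩ := hmem x hx 0
  have : g = 1 := by
    -- With r = 0 any m ≥ 2 would do; 2 has norm 4, so its powers separate ℤ[λ].
    refine eq_one_of_delta_mem_pow (R := QuadraticAlgebra ℤ 1 τ) (m := 2) le_rfl (r := 0)
      (dvd_zero _) (fun y hy => ?_) fun k => ?_
    · refine QuadraticAlgebra.eq_zero_of_forall_pow_dvd hτ ?_ hy
      rw [QuadraticAlgebra.norm_intCast]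
      norm_num
    · obtain ⟨g', hg', e⟩ := hmem _ hx k
      rwa [inl_injective e] at hg'
  rw [this, map_one]
  exact one_mem _

/-- Two adjacent transpositions in S₃ do not commute, so [x,y] ≠ 1. -/
theorem lcs_two_ne_bot (φ : MulAut (FreeGroup (Fin 2))) : lcs (FreeTwoByZ φ) 2 ≠ ⊥ := by
  intro h
  have h2 : lcs (FreeTwoByZ φ) 2 = _ := lcs_nat (FreeTwoByZ φ) 1
  have hm : (inl ⁅FreeGroup.of (0 : Fin 2), FreeGroup.of (1 : Fin 2)⁆ : FreeTwoByZ φ) ∈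
      lcs (FreeTwoByZ φ) 2 := by
    rw [h2]
    exact commutator_mem_fiberLCS (φ := φ) (by rw [fiberLCS_zero]; trivial) _
  rw [h, Subgroup.mem_bot, map_eq_one_iff _ inl_injective] at hm
  have := congrArg (FreeGroup.lift ![Equiv.swap (0 : Fin 3) 1, Equiv.swap 1 2]) hm
  rw [map_commutatorElement, FreeGroup.lift_apply_of, FreeGroup.lift_apply_of, map_one] at this
  revert this
  decide

theorem lcs_trichotomy (φ : MulAut (FreeGroup (Fin 2))) :
    lcs (FreeTwoByZ φ) Ordinal.omega0 = lcs (FreeTwoByZ φ) 2 ∨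
      lcs (FreeTwoByZ φ) Ordinal.omega0 = ⊥ ∨
      (lcs (FreeTwoByZ φ) (Ordinal.omega0 ^ 2) = ⊥ ∧
        IsLowerCentralLength (FreeTwoByZ φ) (Ordinal.omega0 ^ 2)) := by
  rcases autMatrix_det φ with hd | hd
  · by_cases h1 : (2 - (autMatrix φ).trace).natAbs = 1
    · exact Or.inl (lcs_omega_eq_two (by rw [hd]; omega))
    · obtain ⟨p, hp, hpd⟩ := Nat.exists_prime_and_dvd h1
      refine Or.inr (Or.inl (lcs_omega_eq_bot hp ?_ (by simp [hd])))
      rw [← dvd_neg, neg_sub]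
      exact Int.natCast_dvd.2 hpd
  · rcases Int.even_or_odd (autMatrix φ).trace with he | ho
    · refine Or.inr (Or.inl (lcs_omega_eq_bot Nat.prime_two ?_ ?_))
      · exact dvd_sub he.two_dvd dvd_rfl
      · rw [hd]; norm_num
    · by_cases h1 : |(autMatrix φ).trace| = 1
      · refine Or.inl (lcs_omega_eq_two ?_)
        rw [hd]
        rcases eq_or_eq_neg_of_abs_eq h1 with h | h <;> rw [h] <;> norm_num
      · have h3 : 3 ≤ |(autMatrix φ).trace| := by
          obtain ⟨m, hm⟩ := ho
          rcases abs_cases (autMatrix φ).trace with h | h <;> omega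
        have hb := lcs_omega_sq_eq_bot hd h3
        exact Or.inr (Or.inr ⟨hb, isLowerCentralLength_omega_sq _ hb (lcs_omega_mul_ne_bot hd ho)⟩)

end

theorem mainTheorem2 (φ : MulAut (FreeGroup (Fin 2))) :
    (lcs (FreeTwoByZ φ) Ordinal.omega0 = lcs (FreeTwoByZ φ) 2 ∨
      lcs (FreeTwoByZ φ) Ordinal.omega0 = ⊥ ∨
      (lcs (FreeTwoByZ φ) (Ordinal.omega0 ^ 2) = ⊥ ∧
        IsLowerCentralLength (FreeTwoByZ φ) (Ordinal.omega0 ^ 2))) ∧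
    ¬ (lcs (FreeTwoByZ φ) Ordinal.omega0 = lcs (FreeTwoByZ φ) 2 ∧
        lcs (FreeTwoByZ φ) Ordinal.omega0 = ⊥) ∧
    ¬ (lcs (FreeTwoByZ φ) Ordinal.omega0 = lcs (FreeTwoByZ φ) 2 ∧
        (lcs (FreeTwoByZ φ) (Ordinal.omega0 ^ 2) = ⊥ ∧
          IsLowerCentralLength (FreeTwoByZ φ) (Ordinal.omega0 ^ 2))) ∧
    ¬ (lcs (FreeTwoByZ φ) Ordinal.omega0 = ⊥ ∧
        (lcs (FreeTwoByZ φ) (Ordinal.omega0 ^ 2) = ⊥ ∧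
          IsLowerCentralLength (FreeTwoByZ φ) (Ordinal.omega0 ^ 2))) := by
  have hlt : Ordinal.omega0 < Ordinal.omega0 ^ 2 := by
    rw [pow_two]
    exact lt_mul_of_one_lt_right Ordinal.omega0_pos Ordinal.one_lt_omega0
  refine ⟨lcs_trichotomy φ, ?_, ?_, ?_⟩
  · rintro ⟨h1, h2⟩
    exact lcs_two_ne_bot φ (h1.symm.trans h2)
  -- Here γ_2 = γ_3, as γ_3 lies between γ_ω and γ_2: the series stops at 2 < ω².
  · rintro ⟨h1, _, h3⟩
    refine not_isLowerCentralLength_omega_sq _ (β := 2) (by norm_num)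
      ((Ordinal.natCast_lt_omega0 2).trans hlt) (le_antisymm ?_ (lcs_antitone _ (by simp))) h3
    rw [← h1]
    exact lcs_antitone _ (by
      rw [show (2 : Ordinal) + 1 = (3 : ℕ) by norm_num]; exact (Ordinal.natCast_lt_omega0 3).le)
  -- A trivial γ_ω stops the series at ω < ω².
  · rintro ⟨h1, _, h3⟩
    refine not_isLowerCentralLength_omega_sq _ Ordinal.one_lt_omega0.le hlt ?_ h3
    rw [lcs_add_one _ Ordinal.one_lt_omega0.le, h1, Subgroup.commutator_bot_left]
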